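/- **Setting.** Let $M$ be a smooth compact (Hausdorff) $3$-manifold with a smooth contact form $\eta$ ($\eta\wedge d\eta\neq 0$ everywhere) whose characteristic vector field $T$ (defined by $\eta(T)=1$, $T\lrcorner d\eta=0$) generates a smooth free action $\{U_\phi : \phi\in\mathbb R/2\pi\mathbb Z\}$ of the circle. Let $\Sigma=M/S^1$ be the smooth surface of orbits, $p:M\to\Sigma$ the projection (a smooth surjective submersion whose fibres are the orbits), and $\omega$ the oriented area form on $\Sigma$ with $d\eta=p^*\omega$. Such $p:M\to\Sigma$ is called a contact circle bundle. Put $HM=\ker\eta$. A CR structure on $M$ is a smooth complex structure $J$ on the bundle $HM$ ($J^2=-\mathrm{id}$). **Quasiconformality on $M$.** Let $M_1,M_0$ denote $M$ with CR structures $J_1,J_0$, and let $|\cdot|_j$ be the norm of any $J_j$-Hermitian metric on $HM$. A homeomorphism $f:M_1\to M_0$ is *quasiconformal* if 1. $f$ is ACL: for every open $U\subset M$ and every smooth fibration of $U$ by smooth curves tangent to $HM$, $f$ is absolutely continuous along all of these curves except for a subfamily whose intersection with every smooth surface in $U$ transversal to the curves has area zero; 2. $f$ is differentiable almost everywhere,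 and almost everywhere its differential $f_*$ maps $HM$ into $HM$; 3. the maximal dilatation $$K(f)=\operatorname*{ess\,sup}_{x\in M}\ \frac{\max\{|f_*X|_0 : X\in H_xM,\ |X|_1=1\}}{\min\{|f_*X|_0 : X\in H_xM,\ |X|_1=1\}}$$ is finite (the quotient being $\infty$ when the minimum is $0$; it does not depend on the choice of the Hermitian metrics). **Quasiconformality on $\Sigma$.** For Riemannian metrics $g_1,g_0$ on $\Sigma$, a homeomorphism $F:(\Sigma,g_1)\to(\Sigma,g_0)$ is *quasiconformal* (in the classical analytic sense) if it is absolutely continuous on almost every segment parallel to a side of each closed rectangle in each $g_1$-conformal chart, is differentiable almost everywhere, and its maximal dilatation $K(F)$, the essential supremum of $\max|F_*u|_{g_0}/\min|F_*u|_{g_0}$ over $g_1$-unit vectors $u$, is finite. **Theorem.** Let $p:M\to\Sigma$ be a contact circle bundle as above with $\Sigma$ homeomorphic to $S^2$. For $j=0,1$ let $g_j$ be a smooth Riemannian metric on $\Sigma$ whose oriented area form is $\omega$, and let $\Sigma_j=(\Sigma,g_j)$, with the complex structure $J_j'$ determined by $g_j(u,v)=\omega(u,J_j'v)$. Let $M_j$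 be $M$ with the $S^1$-invariant CR structure $J_j$ for which $p:M_j\to\Sigma_j$ is CR, i.e. $p_*J_jX=J_j'p_*X$ for $X\in HM$. Let $F:\Sigma_1\to\Sigma_0$ be a $C^1$ quasiconformal homeomorphism which preserves the oriented $\omega$-area, i.e. $F^*\omega=\omega$. Then there is a quasiconformal homeomorphism $f:M_1\to M_0$ that is equivariant ($f\circ U_\phi=U_\phi\circ f$ for all $\phi$) and satisfies $$p\circ f=F\circ p\qquad\text{and}\qquad K(f)=K(F).$$ -/

import Mathlib

open Set MeasureTheory Bundle
open scoped Manifold ContDiff ENNReal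

noncomputable section

universe u

namespace CRQuasiconformal

/-! ### Notions on a smooth `n`-manifold -/

/-- A field of `1`-forms on an `n`-manifold. -/
abbrev OneForm (n : ℕ) (X : Type*) [TopologicalSpace X]
    [ChartedSpace (EuclideanSpace ℝ (Fin n)) X] : Type _ :=
  ∀ x : X, TangentSpace (𝓡 n) x →L[ℝ] ℝ

/-- A field of bilinear forms on the tangent spaces of an `n`-manifold. -/
abbrev BilinField (n : ℕ) (X : Type*) [TopologicalSpace X]
    [ChartedSpace (EuclideanSpace ℝ (Fin n)) X] : Type _ :=
  ∀ x : X, TangentSpace (𝓡 n) x →L[ℝ] TangentSpace (𝓡 n) x →L[ℝ] ℝ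

/-- The coordinate expression of a `1`-form in the preferred chart at `x₀`: its pullback under the
inverse of that chart, a `1`-form on (an open subset of) `ℝⁿ`. -/
def OneForm.inChart {n : ℕ} {X : Type*} [TopologicalSpace X]
    [ChartedSpace (EuclideanSpace ℝ (Fin n)) X] (α : OneForm n X) (x₀ : X)
    (y : EuclideanSpace ℝ (Fin n)) : EuclideanSpace ℝ (Fin n) →L[ℝ] ℝ :=
  (α ((extChartAt (𝓡 n) x₀).symm y)).comp (mfderiv (𝓡 n) (𝓡 n) (extChartAt (𝓡 n) x₀).symm y)

/-- The exterior derivative of a `1`-form, `dα(u, v) = D_u α (v) - D_v α (u)`, computed at `x` in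
the preferred chart at `x` (this is the normalization
`dα(X, Y) = X (α Y) - Y (α X) - α [X, Y]`). -/
def OneForm.d {n : ℕ} {X : Type*} [TopologicalSpace X]
    [ChartedSpace (EuclideanSpace ℝ (Fin n)) X] (α : OneForm n X) (x : X)
    (u v : TangentSpace (𝓡 n) x) : ℝ :=
  let φ := extChartAt (𝓡 n) x
  let u' : EuclideanSpace ℝ (Fin n) := mfderiv (𝓡 n) (𝓡 n) φ x u
  let v' : EuclideanSpace ℝ (Fin n) := mfderiv (𝓡 n) (𝓡 n) φ x v
  fderiv ℝ (α.inChart x) (φ x) u' v' - fderiv ℝ (α.inChart x) (φ x) v' u'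

/-- Sets of measure zero in an `n`-manifold: Lebesgue null in the charts. -/
def IsNull (n : ℕ) {X : Type*} [TopologicalSpace X] [ChartedSpace (EuclideanSpace ℝ (Fin n)) X]
    (N : Set X) : Prop :=
  ∀ x : X, volume (chartAt (EuclideanSpace ℝ (Fin n)) x ''
    (N ∩ (chartAt (EuclideanSpace ℝ (Fin n)) x).source)) = 0

/-- The essential supremum of a function on an `n`-manifold. -/
def manifoldEssSup (n : ℕ) {X : Type*} [TopologicalSpace X]
    [ChartedSpace (EuclideanSpace ℝ (Fin n)) X] (k : X → ℝ≥0∞) : ℝ≥0∞ :=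
  sInf {c | IsNull n {x | c < k x}}

/-- Absolute continuity on `[a, b]` of a path in a smooth manifold: its composition with every
smooth real function is absolutely continuous (for continuous paths this is absolute continuity
in local coordinates). -/
def ACPath (n : ℕ) {X : Type*} [TopologicalSpace X] [ChartedSpace (EuclideanSpace ℝ (Fin n)) X]
    (c : ℝ → X) (a b : ℝ) : Prop :=
  ∀ h : X → ℝ, ContMDiff (𝓡 n) 𝓘(ℝ, ℝ) ∞ h → AbsolutelyContinuousOnInterval (h ∘ c) a b

/-- The linear dilatation `max |L X| / min |L X|` over the unit vectors `X` of a subspace `H`, with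
respect to norms `N₁` on the source and `N₀` on the target. It is `∞` if the minimum vanishes. -/
def dilatation {V W : Type*} (H : Set V) (N₁ : V → ℝ) (N₀ : W → ℝ) (L : V → W) : ℝ≥0∞ :=
  let mx : ℝ≥0∞ := ⨆ X ∈ {X | X ∈ H ∧ N₁ X = 1}, ENNReal.ofReal (N₀ (L X))
  let mn : ℝ≥0∞ := ⨅ X ∈ {X | X ∈ H ∧ N₁ X = 1}, ENNReal.ofReal (N₀ (L X))
  open Classical in if mn = 0 then ⊤ else mx / mn

/-! ### Contact circle bundles -/

/-- A contact circle bundle `p : M → S`. The `3`-manifold `M` carries a contact form `η` whose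
characteristic (Reeb) vector field `T` generates a free action `U` of the circle `ℝ / 2πℤ`; `S` is
the surface of orbits, `p` is the projection, and `area` is the area form `ω` on `S` with
`dη = p^* ω`. -/
structure ContactCircleBundle (M : Type*) [TopologicalSpace M]
    [ChartedSpace (EuclideanSpace ℝ (Fin 3)) M] [IsManifold (𝓡 3) ∞ M]
    (S : Type*) [TopologicalSpace S]
    [ChartedSpace (EuclideanSpace ℝ (Fin 2)) S] [IsManifold (𝓡 2) ∞ S] where
  /-- the contact form -/
  η : OneForm 3 M
  η_smooth : ContMDiff (𝓡 3) ((𝓡 3).prod 𝓘(ℝ, EuclideanSpace ℝ (Fin 3) →L[ℝ] ℝ)) ∞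
    (fun x ↦ TotalSpace.mk' (EuclideanSpace ℝ (Fin 3) →L[ℝ] ℝ)
      (E := fun x : M ↦ TangentSpace (𝓡 3) x →L[ℝ] Trivial M ℝ x) x (η x))
  /-- `η ∧ dη` vanishes nowhere -/
  contact : ∀ x, ∃ u v w : TangentSpace (𝓡 3) x,
    η x u * η.d x v w + η x v * η.d x w u + η x w * η.d x u v ≠ 0
  /-- the characteristic vector field -/
  T : ∀ x : M, TangentSpace (𝓡 3) x
  T_smooth : ContMDiff (𝓡 3) (𝓡 3).tangent ∞ (fun x ↦ (⟨x, T x⟩ : TangentBundle (𝓡 3) M))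
  η_T : ∀ x, η x (T x) = 1
  dη_T : ∀ x v, η.d x (T x) v = 0
  /-- the circle action -/
  U : Real.Angle → M → M
  U_zero : ∀ x, U 0 x = x
  U_add : ∀ θ φ x, U (θ + φ) x = U θ (U φ x)
  U_smooth : ContMDiff (𝓘(ℝ, ℝ).prod (𝓡 3)) (𝓡 3) ∞ (fun z : ℝ × M ↦ U (z.1 : Real.Angle) z.2)
  U_flow : ∀ x, IsMIntegralCurve (I := 𝓡 3) (fun t : ℝ ↦ U (t : Real.Angle) x) T
  U_free : ∀ θ x, U θ x = x → θ = 0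
  /-- the projection onto the orbit space -/
  p : M → S
  p_smooth : ContMDiff (𝓡 3) (𝓡 2) ∞ p
  p_surjective : Function.Surjective p
  p_submersion : ∀ x, Function.Surjective (mfderiv (𝓡 3) (𝓡 2) p x)
  p_eq_iff : ∀ x y, p x = p y ↔ ∃ θ, U θ x = y
  /-- the area form `ω` on the orbit space -/
  area : BilinField 2 S
  area_smooth : ContMDiff (𝓡 2)
    ((𝓡 2).prod 𝓘(ℝ, EuclideanSpace ℝ (Fin 2) →L[ℝ] EuclideanSpace ℝ (Fin 2) →L[ℝ] ℝ)) ∞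
    (fun q ↦ TotalSpace.mk'
      (EuclideanSpace ℝ (Fin 2) →L[ℝ] EuclideanSpace ℝ (Fin 2) →L[ℝ] ℝ)
      (E := fun q : S ↦ TangentSpace (𝓡 2) q →L[ℝ] TangentSpace (𝓡 2) q →L[ℝ] Trivial S ℝ q)
      q (area q))
  area_alt : ∀ q u, area q u u = 0
  dη_eq : ∀ x u v, η.d x u v = area (p x) (mfderiv (𝓡 3) (𝓡 2) p x u) (mfderiv (𝓡 3) (𝓡 2) p x v)

/-! ### CR structures on a contact 3-manifold -/

section CR

variable {M : Type u} [TopologicalSpace M] [ChartedSpace (EuclideanSpace ℝ (Fin 3)) M]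
  [IsManifold (𝓡 3) ∞ M]

/-- The contact plane `H_x = ker η_x`. -/
def contactPlane (η : OneForm 3 M) (x : M) : Set (TangentSpace (𝓡 3) x) := {v | η x v = 0}

/-- A smooth CR structure with underlying contact bundle `ker η`: a smooth field of endomorphisms
`J` preserving `ker η` with `J² = -1` there. Only the restriction of `J` to `ker η` is meaningful;
its values elsewhere are never used. (Every smooth endomorphism of the subbundle `ker η` extends
to a smooth endomorphism of the tangent bundle.) -/
structure CRStructure (η : OneForm 3 M) where
  J : ∀ x : M, TangentSpace (𝓡 3) x →L[ℝ] TangentSpace (𝓡 3) x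
  smooth : ContMDiff (𝓡 3)
    ((𝓡 3).prod 𝓘(ℝ, EuclideanSpace ℝ (Fin 3) →L[ℝ] EuclideanSpace ℝ (Fin 3))) ∞
    (fun x ↦ TotalSpace.mk' (EuclideanSpace ℝ (Fin 3) →L[ℝ] EuclideanSpace ℝ (Fin 3))
      (E := fun x : M ↦ TangentSpace (𝓡 3) x →L[ℝ] TangentSpace (𝓡 3) x) x (J x))
  mapsTo : ∀ x, ∀ X ∈ contactPlane η x, J x X ∈ contactPlane η x
  sq : ∀ x, ∀ X ∈ contactPlane η x, J x (J x X) = -X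

/-- The norm on `ker η` of the Hermitian (Levi) metric `±dη(X, J Y)`. On each contact plane, a real
plane, any other `J`-Hermitian metric is a multiple of it, so the dilatation below is the one
computed with any Hermitian metrics. -/
def CRStructure.norm {η : OneForm 3 M} (J : CRStructure η) (x : M) (X : TangentSpace (𝓡 3) x) : ℝ :=
  √|η.d x X (J.J x X)|

/-- A fibration `proj : U → B` of the open set `U ⊆ M` over a surface `B` by smooth Legendrian curves,
namely the fibres of `proj`. -/
structure IsContactFibration (η : OneForm 3 M) (U : Set M) {B : Type*} [TopologicalSpace B]
    [ChartedSpace (EuclideanSpace ℝ (Fin 2)) B] (proj : M → B) : Prop where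
  isOpen : IsOpen U
  smooth : ContMDiffOn (𝓡 3) (𝓡 2) ∞ proj U
  surjOn : proj '' U = univ
  submersion : ∀ x ∈ U, Function.Surjective (mfderiv (𝓡 3) (𝓡 2) proj x)
  connected : ∀ b, IsConnected (U ∩ proj ⁻¹' {b})
  legendrian : ∀ x ∈ U, ∀ v : TangentSpace (𝓡 3) x,
    mfderiv (𝓡 3) (𝓡 2) proj x v = 0 → v ∈ contactPlane η x

/-- `f` is absolutely continuous along the curve `γ ⊆ M`: it is so on each compact arc of each
regular smooth parametrization of (a part of) `γ`. -/
def ACAlong (f : M → M) (γ : Set M) : Prop :=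
  ∀ c : ℝ → M, ContMDiff 𝓘(ℝ, ℝ) (𝓡 3) ∞ c → (∀ t, c t ∈ γ) →
    (∀ t, mfderiv 𝓘(ℝ, ℝ) (𝓡 3) c t (1 : ℝ) ≠ 0) → ∀ a b : ℝ, ACPath 3 (f ∘ c) a b

/-- ACL maps of a contact manifold: for each contact fibration `proj : U → B`, `f` is absolutely
continuous along all fibres outside a family of measure zero, that is, a family whose
intersection with each smooth (parametrized) surface `σ : V → U`, `V ⊆ ℝ²` open, transversal
to the fibres is of measure zero. -/
def IsACL (η : OneForm 3 M) (f : M → M) : Prop :=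
  ∀ (B : Type u) [TopologicalSpace B] [ChartedSpace (EuclideanSpace ℝ (Fin 2)) B]
    [IsManifold (𝓡 2) ∞ B] [T2Space B] (U : Set M) (proj : M → B), IsContactFibration η U proj →
    ∀ (V : Set (EuclideanSpace ℝ (Fin 2))) (σ : EuclideanSpace ℝ (Fin 2) → M), IsOpen V →
      ContMDiffOn (𝓡 2) (𝓡 3) ∞ σ V → MapsTo σ V U →
      (∀ s ∈ V, Function.Injective fun v : TangentSpace (𝓡 2) s ↦
        mfderiv (𝓡 3) (𝓡 2) proj (σ s) (mfderiv (𝓡 2) (𝓡 3) σ s v)) →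
      volume {s ∈ V | ¬ ACAlong f (U ∩ proj ⁻¹' {proj (σ s)})} = 0

/-- The dilatation `K(f)(x)` of `f : (M, J₁) → (M, J₀)` at a point. -/
def crDilatation {η : OneForm 3 M} (J₁ J₀ : CRStructure η) (f : M → M) (x : M) : ℝ≥0∞ :=
  dilatation (contactPlane η x) (J₁.norm x) (J₀.norm (f x)) (mfderiv (𝓡 3) (𝓡 3) f x)

/-- The maximal dilatation `K(f)` of `f : (M, J₁) → (M, J₀)`. -/
def crMaxDilatation {η : OneForm 3 M} (J₁ J₀ : CRStructure η) (f : M → M) : ℝ≥0∞ :=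
  manifoldEssSup 3 (crDilatation J₁ J₀ f)

/-- Quasiconformal homeomorphisms `f : (M, J₁) → (M, J₀)` of CR manifolds. -/
structure IsCRQuasiconformal {η : OneForm 3 M} (J₁ J₀ : CRStructure η) (f : M ≃ₜ M) : Prop where
  acl : IsACL η f
  ae_contact : IsNull 3 {x | ¬ (MDifferentiableAt (𝓡 3) (𝓡 3) f x ∧
    ∀ X ∈ contactPlane η x, mfderiv (𝓡 3) (𝓡 3) f x X ∈ contactPlane η (f x))}
  bounded : crMaxDilatation J₁ J₀ f < ⊤

end CR

/-! ### Riemannian surfaces -/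

section Surface

variable {S : Type*} [TopologicalSpace S] [ChartedSpace (EuclideanSpace ℝ (Fin 2)) S]
  [IsManifold (𝓡 2) ∞ S]

/-- Smooth Riemannian metrics on a surface. -/
abbrev SurfaceMetric (S : Type*) [TopologicalSpace S] [ChartedSpace (EuclideanSpace ℝ (Fin 2)) S]
    [IsManifold (𝓡 2) ∞ S] : Type _ :=
  ContMDiffRiemannianMetric (𝓡 2) ∞ (EuclideanSpace ℝ (Fin 2))
    (fun q : S ↦ TangentSpace (𝓡 2) q)

/-- The `2`-form `area` is the oriented area form of `g` (for the orientation given by `area`). -/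
def IsAreaForm (g : SurfaceMetric S) (area : BilinField 2 S) : Prop :=
  ∀ q (u v : TangentSpace (𝓡 2) q),
    area q u v ^ 2 = g.inner q u u * g.inner q v v - g.inner q u v ^ 2

/-- `J` is the complex structure determined by the metric `g` with oriented area form `area`, i.e.
rotation by a positive right angle: `g(u, v) = area(u, J v)`. -/
def IsComplexStructureOf (g : SurfaceMetric S) (area : BilinField 2 S)
    (J : ∀ q : S, TangentSpace (𝓡 2) q →L[ℝ] TangentSpace (𝓡 2) q) : Prop :=
  ∀ q (u v : TangentSpace (𝓡 2) q), g.inner q u v = area q u (J q v)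

/-- A smooth chart that is conformal for the metric `g`. -/
def IsConformalChart (g : SurfaceMetric S)
    (e : OpenPartialHomeomorph S (EuclideanSpace ℝ (Fin 2))) : Prop :=
  e ∈ IsManifold.maximalAtlas (𝓡 2) ∞ S ∧
  ∀ q ∈ e.source, ∃ l : ℝ, 0 < l ∧ ∀ u : TangentSpace (𝓡 2) q,
    g.inner q u u = l * ‖(mfderiv (𝓡 2) (𝓡 2) e q u : EuclideanSpace ℝ (Fin 2))‖ ^ 2

/-- ACL maps of a Riemannian surface: on each closed rectangle in a conformal chart, `F` is
absolutely continuous on almost all segments parallel to the sides. -/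
def IsSurfaceACL (g : SurfaceMetric S) (F : S → S) : Prop :=
  ∀ e, IsConformalChart g e → ∀ a b c d : ℝ, a ≤ b → c ≤ d →
    (∀ x ∈ Icc a b, ∀ y ∈ Icc c d, (!₂[x, y] : EuclideanSpace ℝ (Fin 2)) ∈ e.target) →
    (∀ᵐ y : ℝ, y ∈ Icc c d → ACPath 2 (fun x ↦ F (e.symm !₂[x, y])) a b) ∧
    (∀ᵐ x : ℝ, x ∈ Icc a b → ACPath 2 (fun y ↦ F (e.symm !₂[x, y])) c d)

/-- The dilatation `K(F)(q)` of `F : (S, g₁) → (S, g₀)` at a point. -/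
def surfaceDilatation (g₁ g₀ : SurfaceMetric S) (F : S → S) (q : S) : ℝ≥0∞ :=
  dilatation univ (fun u : TangentSpace (𝓡 2) q ↦ √(g₁.inner q u u))
    (fun v : TangentSpace (𝓡 2) (F q) ↦ √(g₀.inner (F q) v v)) (mfderiv (𝓡 2) (𝓡 2) F q)

/-- The maximal dilatation `K(F)` of `F : (S, g₁) → (S, g₀)`. -/
def surfaceMaxDilatation (g₁ g₀ : SurfaceMetric S) (F : S → S) : ℝ≥0∞ :=
  manifoldEssSup 2 (surfaceDilatation g₁ g₀ F)

/-- Quasiconformal homeomorphisms `F : (S, g₁) → (S, g₀)` of Riemannian surfaces, by the classical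
analytic definition. (Preservation of orientation is not part of this definition.) -/
structure IsSurfaceQuasiconformal (g₁ g₀ : SurfaceMetric S) (F : S ≃ₜ S) : Prop where
  acl : IsSurfaceACL g₁ F
  ae_differentiable : IsNull 2 {q | ¬ MDifferentiableAt (𝓡 2) (𝓡 2) F q}
  bounded : surfaceMaxDilatation g₁ g₀ F < ⊤

/-- A `C¹` map preserves (oriented) area: `F^* area = area`. -/
def PreservesArea (area : BilinField 2 S) (F : S → S) : Prop :=
  ∀ q (u v : TangentSpace (𝓡 2) q),
    area (F q) (mfderiv (𝓡 2) (𝓡 2) F q u) (mfderiv (𝓡 2) (𝓡 2) F q v) = area q u v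

end Surface

/-! ### Invariant CR structures on a contact circle bundle -/

section Bundle

variable {M : Type*} [TopologicalSpace M] [ChartedSpace (EuclideanSpace ℝ (Fin 3)) M]
  [IsManifold (𝓡 3) ∞ M] {S : Type*} [TopologicalSpace S]
  [ChartedSpace (EuclideanSpace ℝ (Fin 2)) S] [IsManifold (𝓡 2) ∞ S]

/-- The CR structure is `S¹`-invariant: each `U_θ` is a CR map. -/
def IsInvariant (P : ContactCircleBundle M S) (J : CRStructure P.η) : Prop :=
  ∀ θ x, ∀ X ∈ contactPlane P.η x,
    mfderiv (𝓡 3) (𝓡 3) (P.U θ) x X ∈ contactPlane P.η (P.U θ x) ∧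
    mfderiv (𝓡 3) (𝓡 3) (P.U θ) x (J.J x X) =
      J.J (P.U θ x) (mfderiv (𝓡 3) (𝓡 3) (P.U θ) x X)

/-- The projection `p : (M, J) → (S, g)` is CR for the complex structure of `S` determined by the
metric `g`, whose oriented area form is `P.area`. -/
def IsCRProjection (P : ContactCircleBundle M S) (J : CRStructure P.η) (g : SurfaceMetric S) :
    Prop :=
  ∃ J' : ∀ q : S, TangentSpace (𝓡 2) q →L[ℝ] TangentSpace (𝓡 2) q,
    IsComplexStructureOf g P.area J' ∧
    ∀ x, ∀ X ∈ contactPlane P.η x,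
      mfderiv (𝓡 3) (𝓡 2) P.p x (J.J x X) = J' (P.p x) (mfderiv (𝓡 3) (𝓡 2) P.p x X)

/-- `f : M → M` is `S¹`-equivariant. -/
def IsEquivariant (P : ContactCircleBundle M S) (f : M → M) : Prop :=
  ∀ θ x, f (P.U θ x) = P.U θ (f x)

end Bundle

end CRQuasiconformal

end

/-! The map `f` is built as an equivariant lift of `F` with `f^* η = η`. Near `q₀` choose a local
section `s` of `p`, and near `F q₀` a section `s'`. An equivariant lift has the form `U_θ (s q) ↦
U_(θ + h q) (s' (F q))`, and it preserves `η` exactly when `dh = s^* η - (s' ∘ F)^* η`. Since `dη =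
p^* ω`, the right side has exterior derivative `ω - F^* ω = 0`, so `h` should come from the Poincaré
lemma. As `F` is only `C¹`, the form `(s' ∘ F)^* η` is merely continuous. The lemma
`exists_hasFDerivAt_sub_pullback` handles this by smoothing `F` in charts and passing to the limit
in the radial homotopy formula, which contains no second derivative of `F`.

Two lifts differ locally by a constant rotation, because their angle functions are primitives of the
same form. Local lifts therefore define a locally constant cocycle with values in the circle group,
which is a coboundary over a disc (`exists_locally_const_coboundary`). The sphere is the union of
two discs with connected intersection. On the intersection the two lifts differ by one rotation,
which can be absorbed (`exists_isLiftOn_univ`).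

The lift is `C¹`, hence ACL, and it preserves `ker η`. On `ker η` the projection `p_*` is an
isometry from the Levi norm to the metric of the surface and carries `f_*` to `F_*`, so the
dilatation of `f` at `x` equals that of `F` at `p x`. The essential suprema agree because the
dilatation of a `C¹` map with nonvanishing differential is lower semicontinuous: its superlevel sets
are open, and an open set is null only if it is empty. No Fubini argument is needed. -/

noncomputable section

namespace CRQuasiconformal

/-! ### Poincaré lemma for pullbacks by `C¹` maps. -/

section Analysis

open Filter Topology Convolution

set_option synthInstance.maxHeartbeats 200000

universe v w

variable {E : Type v} {F : Type w} [NormedAddCommGroup E] [NormedSpace ℝ E] [FiniteDimensional ℝ E]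
  [NormedAddCommGroup F] [NormedSpace ℝ F]

/-- The derivative of the radial primitive of a `1`-form is the form, up to the cone operator applied
to its exterior derivative. -/
theorem hasFDerivAt_radial_primitive {γ : E → E →L[ℝ] F} [CompleteSpace F] (hγ : ContDiff ℝ 1 γ)
    (a x : E) :
    HasFDerivAt (fun x ↦ ∫ t in (0 : ℝ)..1, γ (a + t • (x - a)) (x - a))
      (γ x - ∫ t in (0 : ℝ)..1, t • (fderiv ℝ γ (a + t • (x - a)) (x - a) -
        (fderiv ℝ γ (a + t • (x - a))).flip (x - a))) x := by
  have hγ' : Continuous (fderiv ℝ γ) := hγ.continuous_fderiv one_ne_zero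
  have hγc : Continuous γ := hγ.continuous
  have hflip : Continuous fun y ↦ (fderiv ℝ γ y).flip :=
    (ContinuousLinearMap.flipₗᵢ ℝ E E F).continuous.comp hγ'
  -- The derivative in `x` of the integrand `γ (a + t • (x - a)) (x - a)`; the flip puts the
  -- differentiation variable into the first slot.
  set F' : E → ℝ → E →L[ℝ] F := fun x t ↦
    t • (fderiv ℝ γ (a + t • (x - a))).flip (x - a) + γ (a + t • (x - a)) with hF'
  have hF'c : Continuous (fun z : E × ℝ ↦ F' z.1 z.2) := by
    have h0 : Continuous fun z : E × ℝ ↦ a + z.2 • (z.1 - a) := by fun_prop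
    have h1 := (hflip.comp h0).clm_apply (show Continuous fun z : E × ℝ ↦ z.1 - a by fun_prop)
    exact (continuous_snd.smul h1).add (hγc.comp h0)
  have hdiff : ∀ t : ℝ, ∀ y : E,
      HasFDerivAt (fun x ↦ γ (a + t • (x - a)) (x - a)) (F' y t) y := by
    intro t y
    have h1 : HasFDerivAt (fun x : E ↦ a + t • (x - a)) (t • ContinuousLinearMap.id ℝ E) y :=
      (((hasFDerivAt_id y).sub_const a).const_smul t).const_add a
    have h2 := ((hγ.differentiable one_ne_zero _).hasFDerivAt.comp y h1).clm_apply
      ((hasFDerivAt_id y).sub_const a)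
    refine h2.congr_fderiv ?_
    ext v
    simp [hF', add_comm]
  obtain ⟨C, hC⟩ := ((isCompact_closedBall x 1).prod (isCompact_Icc (a := (0 : ℝ)) (b := 1))).exists_bound_of_continuousOn hF'c.continuousOn
  have key := intervalIntegral.hasFDerivAt_integral_of_dominated_of_fderiv_le (𝕜 := ℝ)
    (μ := volume) (a := 0) (b := 1) (F := fun x t ↦ γ (a + t • (x - a)) (x - a)) (F' := F')
    (x₀ := x) (bound := fun _ ↦ C) (Metric.closedBall_mem_nhds x one_pos)
    (Eventually.of_forall fun y ↦ Continuous.aestronglyMeasurable (by fun_prop))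
    (Continuous.intervalIntegrable (by fun_prop) _ _)
    (hF'c.comp (Continuous.prodMk_right x)).aestronglyMeasurable
    (Eventually.of_forall fun t ht y hy ↦ hC (y, t)
      ⟨hy, Ioc_subset_Icc_self (by rwa [uIoc_of_le zero_le_one] at ht)⟩)
    intervalIntegrable_const (Eventually.of_forall fun t _ y _ ↦ hdiff t y)
  refine key.congr_fderiv ?_
  have hline : ∀ t : ℝ, HasDerivAt (fun t : ℝ ↦ a + t • (x - a)) (x - a) t := fun t ↦ by
    simpa using ((hasDerivAt_id t).smul_const (x - a)).const_add a
  -- Integrating this derivative over `[0, 1]` writes `γ x` as an integral whose integrand differs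
  -- from `F' x t` only by the antisymmetrized derivative of `γ`.
  have hprod : ∀ t : ℝ, HasDerivAt (fun t : ℝ ↦ t • γ (a + t • (x - a)))
      (t • fderiv ℝ γ (a + t • (x - a)) (x - a) + γ (a + t • (x - a))) t := fun t ↦ by
    refine ((hasDerivAt_id t).smul ((hγ.differentiable one_ne_zero _).hasFDerivAt.comp_hasDerivAt t
      (hline t))).congr_deriv ?_
    simp
  have hc0 : Continuous fun t : ℝ ↦ a + t • (x - a) := by fun_prop
  have hc1 : Continuous fun t : ℝ ↦ t • fderiv ℝ γ (a + t • (x - a)) (x - a) :=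
    continuous_id.smul ((hγ'.comp hc0).clm_apply continuous_const)
  have hc2 : Continuous fun t : ℝ ↦ t • (fderiv ℝ γ (a + t • (x - a))).flip (x - a) :=
    continuous_id.smul ((hflip.comp hc0).clm_apply continuous_const)
  have hc3 : Continuous fun t : ℝ ↦ γ (a + t • (x - a)) := hγc.comp hc0
  have hftc := intervalIntegral.integral_eq_sub_of_hasDerivAt (a := 0) (b := 1)
    (fun t _ ↦ hprod t) ((hc1.add hc3).intervalIntegrable _ _)
  have e1 : γ x = ∫ t in (0 : ℝ)..1,
      (t • fderiv ℝ γ (a + t • (x - a)) (x - a) + γ (a + t • (x - a))) := by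
    rw [hftc]; simp
  rw [e1]
  refine Eq.trans ?_ (intervalIntegral.integral_sub ((hc1.add hc3).intervalIntegrable _ _)
    (Continuous.intervalIntegrable ((hc1.sub hc2).congr fun t ↦ (smul_sub _ _ _).symm) _ _))
  refine intervalIntegral.integral_congr fun t _ ↦ ?_
  simp only [hF', smul_sub]
  abel

/-- Convolution of a compactly supported continuous function with bump functions concentrating
at the origin converges uniformly. -/
theorem tendstoUniformly_bump_convolution [MeasurableSpace E] [BorelSpace E] (μ : Measure E)
    [μ.IsAddHaarMeasure] [CompleteSpace F] {φ : ℕ → ContDiffBump (0 : E)}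
    (hφ : Tendsto (fun n ↦ (φ n).rOut) atTop (𝓝 0)) {k : E → F} (hk : Continuous k)
    (hkc : HasCompactSupport k) :
    TendstoUniformly (fun n ↦ ((φ n).normed μ ⋆[ContinuousLinearMap.lsmul ℝ ℝ, μ] k)) k atTop := by
  have hku := hkc.uniformContinuous_of_continuous hk
  rw [Metric.tendstoUniformly_iff]
  intro ε hε
  obtain ⟨δ, hδ, h⟩ := Metric.uniformContinuous_iff.1 hku (ε / 2) (half_pos hε)
  filter_upwards [hφ.eventually_lt_const hδ] with n hn x
  rw [dist_comm]
  exact ((φ n).dist_normed_convolution_le hk.aestronglyMeasurable fun y hy ↦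
    (h (lt_trans (Metric.mem_ball.1 hy) hn)).le).trans_lt (half_lt_self hε)

/-- A compactly supported `C¹` map is a `C¹`-uniform limit of smooth maps. -/
theorem exists_contDiff_tendstoUniformly_fderiv [CompleteSpace F] {g : E → F}
    (hg : ContDiff ℝ 1 g) (hc : HasCompactSupport g) :
    ∃ G : ℕ → E → F, (∀ n, ContDiff ℝ ∞ (G n)) ∧ TendstoUniformly G g atTop ∧
      TendstoUniformly (fun n ↦ fderiv ℝ (G n)) (fderiv ℝ g) atTop := by
  borelize E
  let μ : Measure E := Measure.addHaar
  let φ : ℕ → ContDiffBump (0 : E) := fun n ↦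
    ⟨1 / (n + 2), 1 / (n + 1), by positivity, one_div_lt_one_div_of_lt (by positivity) (by linarith)⟩
  have hφ : Tendsto (fun n ↦ (φ n).rOut) atTop (𝓝 0) :=
    tendsto_one_div_add_atTop_nhds_zero_nat (𝕜 := ℝ)
  have hgl : LocallyIntegrable g μ := hg.continuous.locallyIntegrable
  refine ⟨fun n ↦ (φ n).normed μ ⋆[ContinuousLinearMap.lsmul ℝ ℝ, μ] g, fun n ↦
    HasCompactSupport.contDiff_convolution_left (ContinuousLinearMap.lsmul ℝ ℝ)
      (φ n).hasCompactSupport_normed (φ n).contDiff_normed hgl,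
    tendstoUniformly_bump_convolution μ hφ hg.continuous hc, ?_⟩
  -- The derivative of the convolution may be put on `g`, so the derivatives are bump convolutions
  -- of `fderiv ℝ g`.
  have := tendstoUniformly_bump_convolution μ hφ (hg.continuous_fderiv one_ne_zero) (hc.fderiv ℝ)
  convert! this using 3 with n
  have hφl : LocallyIntegrable ((φ n).normed μ) μ := (φ n).continuous_normed.locallyIntegrable
  funext x
  exact (hc.hasFDerivAt_convolution_right (ContinuousLinearMap.lsmul ℝ ℝ) hφl hg x).fderiv

/-- A map which is `C¹` at a point agrees near the point with a compactly supported `C¹` map. -/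
theorem exists_contDiff_hasCompactSupport_eventuallyEq {g : E → F} {a : E}
    (hg : ContDiffAt ℝ 1 g a) :
    ∃ k : E → F, ContDiff ℝ 1 k ∧ HasCompactSupport k ∧ k =ᶠ[𝓝 a] g := by
  obtain ⟨r, hr, hball⟩ := Metric.eventually_nhds_iff_ball.1
    (hg.eventually (by simp))
  let χ : ContDiffBump a := ⟨r / 4, r / 2, by positivity, by linarith⟩
  refine ⟨fun x ↦ χ x • g x, ?_, χ.hasCompactSupport.smul_right, ?_⟩
  · rw [contDiff_iff_contDiffAt]
    intro x
    by_cases hx : x ∈ Metric.ball a r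
    · exact χ.contDiff.contDiffAt.smul (hball x hx)
    · have : (fun x ↦ χ x • g x) =ᶠ[𝓝 x] fun _ ↦ 0 := by
        have hx' : x ∉ tsupport χ := by
          rw [χ.tsupport_eq]
          intro h
          rw [Metric.mem_ball] at hx
          rw [Metric.mem_closedBall] at h
          change dist x a ≤ r / 2 at h
          linarith
        filter_upwards [(isClosed_tsupport χ).isOpen_compl.mem_nhds hx'] with y hy
        rw [image_eq_zero_of_notMem_tsupport hy, zero_smul]
      exact contDiffAt_const.congr_of_eventuallyEq this
  · filter_upwards [χ.eventuallyEq_one] with x hx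
    simp [hx]

/-- Composition with a continuous map preserves uniform convergence towards a function with
relatively compact range. -/
theorem tendstoUniformlyOn_comp_of_isCompact {ι X Y Z : Type*} [UniformSpace Y] [UniformSpace Z]
    {l : Filter ι} {f : ι → X → Y} {g : X → Y} {s : Set X} {K : Set Y} {Ψ : Y → Z}
    (h : TendstoUniformlyOn f g l s) (hK : IsCompact K) (hgK : MapsTo g s K)
    (hΨ : Continuous Ψ) :
    TendstoUniformlyOn (fun n x ↦ Ψ (f n x)) (fun x ↦ Ψ (g x)) l s := by
  intro r hr
  have := hK.uniformContinuousAt_of_continuousAt Ψ (fun _ _ ↦ hΨ.continuousAt) hr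
  filter_upwards [h _ this] with n hn x hx using hn x hx (hgK hx)

omit [FiniteDimensional ℝ E] in
/-- Radial integrals of uniformly convergent fields of linear maps converge uniformly on balls. -/
theorem tendstoUniformlyOn_radial_integral [CompleteSpace F] {Φ : ℕ → E → E →L[ℝ] F}
    {Φ₀ : E → E →L[ℝ] F} (hΦ : ∀ n, Continuous (Φ n)) (hΦ₀ : Continuous Φ₀)
    (h : TendstoUniformly Φ Φ₀ atTop) {w : ℝ → ℝ} (hw : Continuous w)
    (hw1 : ∀ t ∈ Icc (0 : ℝ) 1, |w t| ≤ 1) (a : E) {r : ℝ} (hr : 0 < r) :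
    TendstoUniformlyOn (fun n x ↦ ∫ t in (0 : ℝ)..1, w t • Φ n (a + t • (x - a)) (x - a))
      (fun x ↦ ∫ t in (0 : ℝ)..1, w t • Φ₀ (a + t • (x - a)) (x - a)) atTop (Metric.ball a r) := by
  rw [Metric.tendstoUniformlyOn_iff]
  intro ε hε
  -- Evaluation at `x - a` costs a factor `r`. The factor `2` leaves room because the integral bound
  -- is not strict.
  filter_upwards [Metric.tendstoUniformly_iff.1 h (ε / (2 * r)) (by positivity)] with n hn x hx
  have hcont : ∀ {Ψ : E → E →L[ℝ] F}, Continuous Ψ →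
      Continuous fun t : ℝ ↦ w t • Ψ (a + t • (x - a)) (x - a) := fun hΨ ↦ by fun_prop
  rw [dist_eq_norm, ← intervalIntegral.integral_sub ((hcont hΦ₀).intervalIntegrable _ _)
    ((hcont (hΦ n)).intervalIntegrable _ _)]
  have hxr : ‖x - a‖ ≤ r := by rw [← dist_eq_norm]; exact (Metric.mem_ball.1 hx).le
  have hb : ∀ t ∈ uIoc (0 : ℝ) 1, ‖w t • Φ₀ (a + t • (x - a)) (x - a) -
      w t • Φ n (a + t • (x - a)) (x - a)‖ ≤ ε / 2 := by
    intro t ht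
    rw [uIoc_of_le zero_le_one] at ht
    rw [← smul_sub, ← sub_apply, norm_smul, Real.norm_eq_abs]
    have h1 := hn (a + t • (x - a))
    rw [dist_eq_norm] at h1
    calc _ ≤ 1 * (ε / (2 * r) * r) := by
          refine mul_le_mul (hw1 t (Ioc_subset_Icc_self ht)) ?_ (norm_nonneg _) zero_le_one
          exact ((ContinuousLinearMap.le_opNorm _ _).trans
            (mul_le_mul h1.le hxr (norm_nonneg _) (by positivity)))
      _ = ε / 2 := by field_simp
  have := intervalIntegral.norm_integral_le_of_norm_le_const hb
  simp only [sub_zero, abs_one, mul_one] at this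
  linarith

/-- The pullback of a bilinear form by a linear map. -/
def pullbackBilin {E' : Type*} [NormedAddCommGroup E'] [NormedSpace ℝ E']
    (T : E' →L[ℝ] E' →L[ℝ] F) (L : E →L[ℝ] E') : E →L[ℝ] E →L[ℝ] F :=
  ((T.comp L).flip.comp L).flip

variable {E' : Type*} [NormedAddCommGroup E'] [NormedSpace ℝ E'] [FiniteDimensional ℝ E']

omit [FiniteDimensional ℝ E] [FiniteDimensional ℝ E'] in
theorem continuous_flip {X : Type*} [TopologicalSpace X] {f : X → E →L[ℝ] E' →L[ℝ] F}
    (hf : Continuous f) : Continuous fun x ↦ (f x).flip :=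
  (ContinuousLinearMap.flipₗᵢ ℝ E E' F).continuous.comp hf

/-- The exterior derivative of a `1`-form on a vector space, as a field of bilinear forms. -/
def extDer (A : E → E →L[ℝ] F) (x : E) : E →L[ℝ] E →L[ℝ] F := fderiv ℝ A x - (fderiv ℝ A x).flip

omit [FiniteDimensional ℝ E] in
theorem continuous_extDer {A : E → E →L[ℝ] F} (hA : ContDiff ℝ 1 A) : Continuous (extDer A) := by
  -- Here `V` stands for the space of bilinear maps and `L` for the flip, regarded as a continuous
  -- linear endomorphism.
  have h : ∀ {V : Type (max v w)} [NormedAddCommGroup V] [NormedSpace ℝ V] (L : V →L[ℝ] V)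
    {f : E → V}, Continuous f → Continuous fun x ↦ f x - L (f x) := fun L _ hf ↦
      hf.sub (L.continuous.comp hf)
  exact h (ContinuousLinearMap.flipₗᵢ ℝ E E F).toContinuousLinearEquiv.toContinuousLinearMap
    (hA.continuous_fderiv one_ne_zero)

omit [FiniteDimensional ℝ E] [FiniteDimensional ℝ E'] in
theorem continuous_pullbackBilin {X : Type*} [TopologicalSpace X] {T : X → E' →L[ℝ] E' →L[ℝ] F}
    {L : X → E →L[ℝ] E'} (hT : Continuous T) (hL : Continuous L) :
    Continuous fun x ↦ pullbackBilin (T x) (L x) :=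
  continuous_flip ((continuous_flip (hT.clm_comp hL)).clm_comp hL)

omit [FiniteDimensional ℝ E] [FiniteDimensional ℝ E'] in
/-- Continuous expressions in a map and its derivative converge uniformly along `C¹`-uniform
limits towards compactly supported maps. -/
theorem tendstoUniformly_comp_fderiv {Z : Type*} [NormedAddCommGroup Z] {Gn : ℕ → E → E'} {G : E → E'}
    (hG : ContDiff ℝ 1 G) (hGc : HasCompactSupport G) (h0 : TendstoUniformly Gn G atTop)
    (h1 : TendstoUniformly (fun n ↦ fderiv ℝ (Gn n)) (fderiv ℝ G) atTop)
    {Ψ : E' × (E →L[ℝ] E') → Z} (hΨ : Continuous Ψ) :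
    TendstoUniformly (fun n x ↦ Ψ (Gn n x, fderiv ℝ (Gn n) x)) (fun x ↦ Ψ (G x, fderiv ℝ G x))
      atTop := by
  have hK : IsCompact (range G ×ˢ range (fderiv ℝ G)) :=
    (hGc.isCompact_range hG.continuous).prod
      ((hGc.fderiv ℝ).isCompact_range (hG.continuous_fderiv one_ne_zero))
  exact tendstoUniformlyOn_univ.1 (tendstoUniformlyOn_comp_of_isCompact
    (tendstoUniformlyOn_univ.2 fun u hu ↦ tendsto_diag.eventually (h0.prodMk h1 u hu)) hK
    (fun x _ ↦ ⟨mem_range_self x, mem_range_self x⟩) hΨ)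

omit [FiniteDimensional ℝ E] [FiniteDimensional ℝ E'] in
/-- The alternating derivative of the pullback of a `1`-form by a `C²` map. -/
theorem extDer_pullback {A : E' → E' →L[ℝ] F} {G : E → E'} {x : E}
    (hA : DifferentiableAt ℝ A (G x)) (hG : ContDiffAt ℝ 2 G x) :
    extDer (fun y ↦ (A (G y)).comp (fderiv ℝ G y)) x =
    pullbackBilin (extDer A (G x)) (fderiv ℝ G x) := by
  have hG1 : DifferentiableAt ℝ G x := hG.differentiableAt (by simp)
  have hG2 : DifferentiableAt ℝ (fderiv ℝ G) x :=
    (hG.fderiv_right (m := 1) (by norm_num)).differentiableAt (by simp)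
  -- The terms containing the second derivative of `G` are symmetric and cancel, so the result
  -- involves only `G` and its first derivative. This is what permits the later passage to `C¹`
  -- maps.
  have hsymm := hG.isSymmSndFDerivAt (by simp)
  have h1 := (hA.hasFDerivAt.comp x hG1.hasFDerivAt).clm_comp hG2.hasFDerivAt
  rw [extDer, show fderiv ℝ (fun y ↦ (A (G y)).comp (fderiv ℝ G y)) x = _ from h1.fderiv]
  ext u v
  simp [pullbackBilin, extDer, hsymm.eq u v]

/-- The radial primitive of the pullback of a `1`-form by a `C¹` map. -/
theorem hasFDerivAt_radial_primitive_pullback {A' : E' → E' →L[ℝ] ℝ} {G : E → E'} (a : E)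
    (hA' : ContDiff ℝ 1 A') (hG : ContDiff ℝ 1 G) (hGc : HasCompactSupport G) (x : E) :
    HasFDerivAt (fun x ↦ ∫ t in (0 : ℝ)..1,
        ((A' (G (a + t • (x - a)))).comp (fderiv ℝ G (a + t • (x - a)))) (x - a))
      ((A' (G x)).comp (fderiv ℝ G x) - ∫ t in (0 : ℝ)..1,
        t • pullbackBilin (extDer A' (G (a + t • (x - a)))) (fderiv ℝ G (a + t • (x - a))) (x - a))
      x := by
  -- The pulled back form is only continuous, so the homotopy formula does not apply directly. It
  -- holds for smooth approximations `Gn`. Their primitives, and the claimed derivatives, converge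
  -- uniformly on a ball containing `x`, so the formula survives in the limit.
  obtain ⟨Gn, hGn, h0, h1⟩ := exists_contDiff_tendstoUniformly_fderiv hG hGc
  have hGn1 : ∀ n, ContDiff ℝ 1 (Gn n) := fun n ↦ (hGn n).of_le (by simp)
  have hΨγ : Continuous fun z : E' × (E →L[ℝ] E') ↦ (A' z.1).comp z.2 :=
    (hA'.continuous.comp continuous_fst).clm_comp continuous_snd
  have hΨB : Continuous fun z : E' × (E →L[ℝ] E') ↦ pullbackBilin (extDer A' z.1) z.2 :=
    continuous_pullbackBilin ((continuous_extDer hA').comp continuous_fst) continuous_snd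
  have hc : ∀ {g : E → E'}, ContDiff ℝ 1 g → Continuous fun x ↦ (g x, fderiv ℝ g x) := fun hg ↦
    hg.continuous.prodMk (hg.continuous_fderiv one_ne_zero)
  have hγlim := tendstoUniformly_comp_fderiv hG hGc h0 h1 hΨγ
  have hBlim := tendstoUniformly_comp_fderiv (Z := E →L[ℝ] E →L[ℝ] ℝ) hG hGc h0 h1 hΨB
  have hr : 0 < dist x a + 1 := by positivity
  have hK0 := tendstoUniformlyOn_radial_integral (fun n ↦ hΨγ.comp (hc (hGn1 n)))
    (hΨγ.comp (hc hG)) hγlim (w := fun _ ↦ 1) continuous_const (by simp) a hr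
  have hK1 := tendstoUniformlyOn_radial_integral (fun n ↦ hΨB.comp (hc (hGn1 n)))
    (hΨB.comp (hc hG)) hBlim (w := fun t ↦ t) continuous_id
    (fun t ht ↦ by rw [abs_of_nonneg ht.1]; exact ht.2) a hr
  simp only [one_smul] at hK0
  refine hasFDerivAt_of_tendstoUniformlyOn (Metric.isOpen_ball (x := a) (ε := dist x a + 1))
    (hγlim.tendstoUniformlyOn.sub hK1) (fun n y _ ↦ ?_)
    (fun y hy ↦ hK0.tendsto_at hy) (Metric.mem_ball.2 (lt_add_one _))
  have hγ1 : ContDiff ℝ 1 fun x ↦ (A' (Gn n x)).comp (fderiv ℝ (Gn n) x) :=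
    (hA'.comp (hGn1 n)).clm_comp ((hGn n).fderiv_right (m := 1) (by norm_cast))
  refine (hasFDerivAt_radial_primitive hγ1 a y).congr_fderiv ?_
  refine congrArg (fun w ↦ (A' (Gn n y)).comp (fderiv ℝ (Gn n) y) - w) ?_
  refine intervalIntegral.integral_congr fun t _ ↦ ?_
  have := extDer_pullback (x := a + t • (y - a)) (hA'.differentiable one_ne_zero _)
    ((hGn n).of_le (by norm_cast)).contDiffAt
  exact congrArg (fun T : E →L[ℝ] E →L[ℝ] ℝ ↦ t • T (y - a)) this

/-- Take the difference of the radial primitives of the two forms. Each differentiates to its form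
minus a correction that depends only on the exterior derivative along the segment from `a`. For `x`
in a ball around `a` this segment stays in the ball, where the exterior derivatives agree, so the
corrections cancel. -/
theorem exists_hasFDerivAt_sub_pullback_of_contDiff {A : E → E →L[ℝ] ℝ} {A' : E' → E' →L[ℝ] ℝ}
    {G : E → E'} {a : E} (hA : ContDiff ℝ 1 A) (hA' : ContDiff ℝ 1 A') (hG : ContDiff ℝ 1 G)
    (hGc : HasCompactSupport G)
    (h : ∀ᶠ x in 𝓝 a, pullbackBilin (extDer A' (G x)) (fderiv ℝ G x) = extDer A x) :
    ∃ k : E → ℝ, ∀ᶠ x in 𝓝 a, HasFDerivAt k ((A' (G x)).comp (fderiv ℝ G x) - A x) x := by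
  obtain ⟨r, hr, hball⟩ := Metric.eventually_nhds_iff_ball.1 h
  refine ⟨fun x ↦ (∫ t in (0 : ℝ)..1,
      ((A' (G (a + t • (x - a)))).comp (fderiv ℝ G (a + t • (x - a)))) (x - a)) -
    ∫ t in (0 : ℝ)..1, A (a + t • (x - a)) (x - a), ?_⟩
  filter_upwards [Metric.ball_mem_nhds a hr] with x hx
  refine ((hasFDerivAt_radial_primitive_pullback a hA' hG hGc x).sub
    (hasFDerivAt_radial_primitive hA a x)).congr_fderiv ?_
  refine (congrArg (fun w ↦ _ - w - _) ?_).trans (sub_sub_sub_cancel_right _ _ _)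
  refine intervalIntegral.integral_congr fun t ht ↦ ?_
  rw [uIcc_of_le zero_le_one] at ht
  have hmem : a + t • (x - a) ∈ Metric.ball a r := by
    rw [Metric.mem_ball, dist_eq_norm] at hx ⊢
    rw [add_sub_cancel_left, norm_smul, Real.norm_eq_abs, abs_of_nonneg ht.1]
    nlinarith [norm_nonneg (x - a), ht.2]
  exact congrArg (fun T : E →L[ℝ] E →L[ℝ] ℝ ↦ t • T (x - a)) (hball _ hmem)

/-- **Poincaré lemma** for the difference of a `1`-form and the pullback of a `1`-form by a map which
is merely `C¹`. -/
theorem exists_hasFDerivAt_sub_pullback {A : E → E →L[ℝ] ℝ} {A' : E' → E' →L[ℝ] ℝ}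
    {G : E → E'} {a : E} (hA : ContDiffAt ℝ 1 A a) (hA' : ContDiffAt ℝ 1 A' (G a))
    (hG : ContDiffAt ℝ 1 G a)
    (h : ∀ᶠ x in 𝓝 a, ∀ u v, fderiv ℝ A' (G x) (fderiv ℝ G x u) (fderiv ℝ G x v) -
      fderiv ℝ A' (G x) (fderiv ℝ G x v) (fderiv ℝ G x u) =
      fderiv ℝ A x u v - fderiv ℝ A x v u) :
    ∃ k : E → ℝ, ∀ᶠ x in 𝓝 a, HasFDerivAt k (A x - (A' (G x)).comp (fderiv ℝ G x)) x := by
  -- Cutoffs make all data global, and `G` compactly supported, without changing germs. The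
  -- primitive so obtained has the opposite sign, hence `-k` below.
  obtain ⟨A₁, hA₁, -, eA⟩ := exists_contDiff_hasCompactSupport_eventuallyEq hA
  obtain ⟨A₁', hA₁', -, eA'⟩ := exists_contDiff_hasCompactSupport_eventuallyEq hA'
  obtain ⟨G₁, hG₁, hG₁c, eG⟩ := exists_contDiff_hasCompactSupport_eventuallyEq hG
  have eA'' := hG.continuousAt.eventually eA'.eventuallyEq_nhds
  obtain ⟨k, hk⟩ := exists_hasFDerivAt_sub_pullback_of_contDiff (a := a) hA₁ hA₁' hG₁ hG₁c (by
    filter_upwards [h, eA.eventuallyEq_nhds, eG.eventuallyEq_nhds, eA''] with x hx e1 e2 e3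
    rw [extDer, extDer, e1.fderiv_eq, e2.fderiv_eq, e2.self_of_nhds, e3.fderiv_eq]
    ext u v
    simpa [pullbackBilin, extDer] using hx u v)
  refine ⟨fun x ↦ -k x, ?_⟩
  filter_upwards [hk, eA.eventuallyEq_nhds, eG.eventuallyEq_nhds, eA''] with x hx e1 e2 e3
  refine hx.neg.congr_fderiv ?_
  rw [neg_sub, e1.self_of_nhds, e2.self_of_nhds, e3.self_of_nhds, e2.fderiv_eq]

end Analysis

/-! ### Pulling back one-forms from manifolds to vector spaces. -/

section Pullback

open Filter Topology

variable {E : Type*} [NormedAddCommGroup E] [NormedSpace ℝ E]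
  {n : ℕ} {X : Type*} [TopologicalSpace X] [ChartedSpace (EuclideanSpace ℝ (Fin n)) X]

/-- The image of a constant vector field on a vector space under the differential of a map into
a manifold is regular. -/
theorem contMDiffAt_mfderiv_const [IsManifold (𝓡 n) ∞ X] {H : E → X} {e : E} {m k : WithTop ℕ∞}
    (hH : ContMDiffAt 𝓘(ℝ, E) (𝓡 n) k H e) (hmk : m + 1 ≤ k) (u : E) :
    ContMDiffAt 𝓘(ℝ, E) (𝓡 n).tangent m
      (fun y ↦ (⟨H y, mfderiv 𝓘(ℝ, E) (𝓡 n) H y u⟩ : TangentBundle (𝓡 n) X)) e := by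
  have : IsManifold (𝓡 n) 1 X := .of_le (n := ∞) (by simp)
  have h1 := hH.mfderiv_const hmk
  have h2 : ContMDiffAt 𝓘(ℝ, E) 𝓘(ℝ, E).tangent m
      (fun y ↦ (⟨y, u⟩ : TangentBundle 𝓘(ℝ, E) E)) e :=
    contMDiffAt_vectorSpace_iff_contDiffAt.2 contDiffAt_const
  exact ContMDiffAt.clm_apply_of_inCoordinates (b₁ := id) (b₂ := H) h1 h2
    (hH.of_le (le_self_add.trans hmk))

/-- The pullback of a `1`-form on a manifold to a vector space. -/
def pullForm (α : OneForm n X) (H : E → X) (e : E) : E →L[ℝ] ℝ :=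
  (α (H e)).comp (mfderiv 𝓘(ℝ, E) (𝓡 n) H e)

theorem pullForm_comp (α : OneForm n X) {E' : Type*} [NormedAddCommGroup E'] [NormedSpace ℝ E']
    {H : E → X} {G : E' → E} {e : E'} (hH : MDifferentiableAt 𝓘(ℝ, E) (𝓡 n) H (G e))
    (hG : DifferentiableAt ℝ G e) :
    pullForm α (H ∘ G) e = (pullForm α H (G e)).comp (fderiv ℝ G e) := by
  unfold pullForm
  rw [mfderiv_comp (I' := 𝓘(ℝ, E)) e hH hG.mdifferentiableAt, mfderiv_eq_fderiv]
  rfl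

theorem pullForm_congr (α : OneForm n X) {H H' : E → X} {e : E} (h : H =ᶠ[𝓝 e] H') :
    pullForm α H e = pullForm α H' e := by
  have key : ∀ {x x' : X} (_ : x = x') {L L' : E →L[ℝ] EuclideanSpace ℝ (Fin n)} (_ : L = L') (w : E),
      α x (L w) = α x' (L' w) := by
    rintro x _ rfl L _ rfl w
    rfl
  ext w
  exact key h.self_of_nhds h.mfderiv_eq w

/-- Expanding in a basis of `E` writes `f` as a finite sum of coordinate functionals tensored with
the values `f y (b i)`. -/
theorem contDiffAt_of_forall_clm_apply [FiniteDimensional ℝ E] {V F : Type*} [NormedAddCommGroup V]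
    [NormedSpace ℝ V] [NormedAddCommGroup F] [NormedSpace ℝ F] {f : V → E →L[ℝ] F} {x : V}
    {m : WithTop ℕ∞} (h : ∀ u, ContDiffAt ℝ m (fun y ↦ f y u) x) : ContDiffAt ℝ m f x := by
  let b := Module.finBasis ℝ E
  have : f = fun y ↦ ∑ i, (LinearMap.toContinuousLinearMap (b.coord i)).smulRight (f y (b i)) := by
    ext y v
    have : f y v = ∑ i, b.repr v i • f y (b i) := by
      conv_lhs => rw [← b.sum_repr v, map_sum]
      simp only [map_smul]
    simpa using this
  rw [this]
  refine ContDiffAt.sum fun i _ ↦ ?_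
  exact (ContinuousLinearMap.smulRightL ℝ E F
    (LinearMap.toContinuousLinearMap (b.coord i))).contDiff.contDiffAt.comp x (h (b i))

variable [IsManifold (𝓡 n) ∞ X]

/-- Smoothness of a `1`-form. -/
def OneForm.IsSmooth (α : OneForm n X) : Prop :=
  ContMDiff (𝓡 n) ((𝓡 n).prod 𝓘(ℝ, EuclideanSpace ℝ (Fin n) →L[ℝ] ℝ)) ∞
    (fun x ↦ TotalSpace.mk' (EuclideanSpace ℝ (Fin n) →L[ℝ] ℝ)
      (E := fun x : X ↦ TangentSpace (𝓡 n) x →L[ℝ] Trivial X ℝ x) x (α x))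

/-- It suffices to evaluate on constant vectors. There the pullback pairs the smooth form along `H`
with the image of a constant field under the differential of `H`, which has one derivative fewer
than `H`. -/
theorem contDiffAt_pullForm [FiniteDimensional ℝ E] {α : OneForm n X} (hα : α.IsSmooth)
    {H : E → X} {e : E} {m k : ℕ∞} (hH : ContMDiffAt 𝓘(ℝ, E) (𝓡 n) k H e) (hmk : m + 1 ≤ k) :
    ContDiffAt ℝ m (pullForm α H) e := by
  have hmk' : (m : WithTop ℕ∞) + 1 ≤ k := by exact_mod_cast hmk
  refine contDiffAt_of_forall_clm_apply fun u ↦ ?_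
  have h1 := contMDiffAt_mfderiv_const hH hmk' u
  have h2 : ContMDiffAt 𝓘(ℝ, E) ((𝓡 n).prod 𝓘(ℝ, EuclideanSpace ℝ (Fin n) →L[ℝ] ℝ)) m
      (fun y ↦ TotalSpace.mk' (EuclideanSpace ℝ (Fin n) →L[ℝ] ℝ)
      (E := fun x : X ↦ TangentSpace (𝓡 n) x →L[ℝ] Trivial X ℝ x) (H y) (α (H y))) e :=
    ((hα.contMDiffAt (x := H e)).of_le (by exact_mod_cast le_top)).comp e
      (hH.of_le (le_self_add.trans hmk'))
  have h3 := ContMDiffAt.clm_bundle_apply (F₂ := ℝ) (E₂ := fun x : X ↦ Trivial X ℝ x) h2 h1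
  rw [Bundle.contMDiffAt_totalSpace] at h3
  exact h3.2.contDiffAt

/-- Exterior differentiation commutes with pullbacks to vector spaces. -/
theorem extDer_pullForm [FiniteDimensional ℝ E] {α : OneForm n X} (hα : α.IsSmooth)
    {H : E → X} {e : E} (hH : ContMDiffAt 𝓘(ℝ, E) (𝓡 n) 2 H e) (u v : E) :
    extDer (pullForm α H) e u v =
      α.d (H e) (mfderiv 𝓘(ℝ, E) (𝓡 n) H e u) (mfderiv 𝓘(ℝ, E) (𝓡 n) H e v) := by
  set φ := extChartAt (𝓡 n) (H e) with hφ
  set G : E → EuclideanSpace ℝ (Fin n) := φ ∘ H with hG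
  have hGc : ContMDiffAt 𝓘(ℝ, E) (𝓡 n) 2 G e := contMDiffAt_extChartAt.comp e hH
  have hG2 : ContDiffAt ℝ 2 G e := hGc.contDiffAt
  have hsource : ∀ᶠ y in 𝓝 e, H y ∈ φ.source :=
    hH.continuousAt.eventually (extChartAt_source_mem_nhds (I := 𝓡 n) (H e))
  have hsymm : ∀ z ∈ φ.target, ContMDiffAt (𝓡 n) (𝓡 n) ∞ φ.symm z := fun z hz ↦
    (contMDiffOn_extChartAt_symm (H e)).contMDiffAt
      ((isOpen_extChartAt_target (I := 𝓡 n) (H e)).mem_nhds hz)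
  -- Factoring `H` through the chart at `H e` reduces the claim to `extDer_pullback` for the map `G`
  -- between vector spaces. This is also the chart in which `OneForm.d` is computed at `H e`.
  have hcongr : pullForm α H =ᶠ[𝓝 e] fun y ↦ (α.inChart (H e) (G y)).comp (fderiv ℝ G y) := by
    filter_upwards [hsource.eventually_nhds, hG2.eventually (by simp)] with y hy hGy
    have h1 : H =ᶠ[𝓝 y] φ.symm ∘ G := hy.mono fun z hz ↦ (φ.left_inv hz).symm
    rw [pullForm_congr α h1, pullForm_comp]
    · rfl
    · exact (hsymm _ (φ.map_source hy.self_of_nhds)).mdifferentiableAt (by simp)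
    · exact hGy.differentiableAt (by simp)
  have hA : DifferentiableAt ℝ (α.inChart (H e)) (G e) :=
    (contDiffAt_pullForm (m := 1) (k := ⊤) hα (hsymm _ (φ.map_source hsource.self_of_nhds))
      (by simp)).differentiableAt (by simp)
  have key := extDer_pullback hA hG2
  have hext : extDer (pullForm α H) e =
      extDer (fun y ↦ (α.inChart (H e) (G y)).comp (fderiv ℝ G y)) e := by
    unfold extDer
    rw [hcongr.fderiv_eq]
  have hd : ∀ w : E, (mfderiv (𝓡 n) (𝓡 n) φ (H e) (mfderiv 𝓘(ℝ, E) (𝓡 n) H e w) :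
      EuclideanSpace ℝ (Fin n)) = fderiv ℝ G e w := by
    intro w
    rw [← mfderiv_eq_fderiv]
    exact (mfderiv_comp_apply e (mdifferentiableAt_extChartAt (mem_chart_source _ _))
      (hH.mdifferentiableAt (by simp)) w).symm
  rw [hext, key]
  simp only [OneForm.d]
  rw [← hφ]
  erw [hd u, hd v]
  simp [pullbackBilin, extDer, hG]

end Pullback

/-- If the exterior derivative of a `1`-form on `ℝ × V` vanishes on the first direction and the form
takes a constant value there, then the form is constant in the first variable. -/
theorem apply_snd_eq_of_extDer_eq_zero {V : Type*} [NormedAddCommGroup V] [NormedSpace ℝ V]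
    {γ : ℝ × V → ℝ × V →L[ℝ] ℝ} {y : V} {c : ℝ} (hγ : ∀ t : ℝ, DifferentiableAt ℝ γ (t, y))
    (hc : ∀ t : ℝ, ∀ᶠ z in nhds (t, y), γ z (1, 0) = c) (w : V)
    (hd : ∀ t : ℝ, extDer γ (t, y) (1, 0) (0, w) = 0) (t : ℝ) :
    γ (t, y) (0, w) = γ (0, y) (0, w) := by
  have hev : ∀ (v : ℝ × V) (t : ℝ), HasFDerivAt (fun z ↦ γ z v)
      ((ContinuousLinearMap.apply ℝ ℝ v).comp (fderiv ℝ γ (t, y))) (t, y) := fun v t ↦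
    (ContinuousLinearMap.apply ℝ ℝ v).hasFDerivAt.comp (t, y) (hγ t).hasFDerivAt
  -- The exterior derivative on `(1, 0)` and `(0, w)` is the `t`-derivative of the `w`-coefficient
  -- minus the `w`-derivative of the `t`-coefficient. The latter vanishes because that coefficient
  -- is locally constant.
  have hzero : ∀ t : ℝ, fderiv ℝ γ (t, y) (1, 0) (0, w) = 0 := by
    intro t
    have h3 : fderiv ℝ γ (t, y) (0, w) (1, 0) = 0 := by
      have h5 := (hev (1, 0) t).unique ((hasFDerivAt_const c _).congr_of_eventuallyEq (hc t))
      exact congrArg (fun L ↦ L (0, w)) h5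
    have h6 : fderiv ℝ γ (t, y) (1, 0) (0, w) - fderiv ℝ γ (t, y) (0, w) (1, 0) = 0 := hd t
    rwa [h3, sub_zero] at h6
  have hderiv : ∀ t : ℝ, HasDerivAt (fun t : ℝ ↦ γ (t, y) (0, w)) 0 t := by
    intro t
    have h1 : HasDerivAt (fun t : ℝ ↦ (t, y)) (1, 0) t :=
      (hasDerivAt_id t).prodMk (hasDerivAt_const t y)
    exact ((hev (0, w) t).comp_hasDerivAt t h1).congr_deriv (hzero t)
  exact is_const_of_deriv_eq_zero (fun t ↦ (hderiv t).differentiableAt)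
    (fun t ↦ (hderiv t).deriv) t 0

theorem mfderiv_extChartAt_symm_apply {n : ℕ} {X : Type*} [TopologicalSpace X]
    [ChartedSpace (EuclideanSpace ℝ (Fin n)) X] [IsManifold (𝓡 n) ∞ X] {x x' : X}
    (hx : x' ∈ (extChartAt (𝓡 n) x).source) (v : TangentSpace (𝓡 n) x') :
    (mfderiv (𝓡 n) (𝓡 n) (extChartAt (𝓡 n) x).symm (extChartAt (𝓡 n) x x')
      (mfderiv (𝓡 n) (𝓡 n) (extChartAt (𝓡 n) x) x' v) : EuclideanSpace ℝ (Fin n)) = v := by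
  have : IsManifold (𝓡 n) 1 X := .of_le (n := ∞) (by simp)
  have h1 : MDifferentiableAt (𝓡 n) (𝓡 n) (extChartAt (𝓡 n) x).symm (extChartAt (𝓡 n) x x') :=
    ((contMDiffOn_extChartAt_symm (n := 1) x).contMDiffAt
      ((isOpen_extChartAt_target (I := 𝓡 n) x).mem_nhds
        ((extChartAt (𝓡 n) x).map_source hx))).mdifferentiableAt (by simp)
  have h2 : MDifferentiableAt (𝓡 n) (𝓡 n) (extChartAt (𝓡 n) x) x' :=
    mdifferentiableAt_extChartAt (by simpa using hx)
  have h3 : (extChartAt (𝓡 n) x).symm ∘ extChartAt (𝓡 n) x =ᶠ[nhds x'] id := by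
    filter_upwards [(isOpen_extChartAt_source (I := 𝓡 n) x).mem_nhds hx] with z hz using
      (extChartAt (𝓡 n) x).left_inv hz
  have h4 := h3.mfderiv_eq (I := 𝓡 n) (I' := 𝓡 n)
  rw [mfderiv_id] at h4
  exact (mfderiv_comp_apply x' h1 h2 v).symm.trans (congrArg (fun L ↦ L v) h4)

/-! ### The circle action and the invariance of the contact form. -/

namespace ContactCircleBundle

open Filter Topology

variable {M : Type*} [TopologicalSpace M] [ChartedSpace (EuclideanSpace ℝ (Fin 3)) M]
  [IsManifold (𝓡 3) ∞ M] {S : Type*} [TopologicalSpace S]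
  [ChartedSpace (EuclideanSpace ℝ (Fin 2)) S] [IsManifold (𝓡 2) ∞ S]
  (P : ContactCircleBundle M S)

theorem U_neg (θ : Real.Angle) (x : M) : P.U (-θ) (P.U θ x) = x := by
  rw [← P.U_add, neg_add_cancel, P.U_zero]

theorem U_neg' (θ : Real.Angle) (x : M) : P.U θ (P.U (-θ) x) = x := by
  rw [← P.U_add, add_neg_cancel, P.U_zero]

theorem U_comm (θ φ : Real.Angle) (x : M) : P.U θ (P.U φ x) = P.U φ (P.U θ x) := by
  rw [← P.U_add, ← P.U_add, add_comm]

theorem p_U (θ : Real.Angle) (x : M) : P.p (P.U θ x) = P.p x :=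
  ((P.p_eq_iff _ _).2 ⟨θ, rfl⟩).symm

theorem U_inj {θ φ : Real.Angle} {x : M} (h : P.U θ x = P.U φ x) : θ = φ := by
  have : P.U (-φ + θ) x = x := by rw [P.U_add, h, P.U_neg]
  have := P.U_free _ _ this
  rwa [neg_add_eq_zero, eq_comm] at this

theorem contMDiff_U (θ : Real.Angle) : ContMDiff (𝓡 3) (𝓡 3) ∞ (P.U θ) := by
  obtain ⟨t, rfl⟩ : ∃ t : ℝ, (t : Real.Angle) = θ := QuotientAddGroup.mk_surjective θ
  exact P.U_smooth.comp (contMDiff_const.prodMk contMDiff_id)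

section Curves

variable {V : Type*} [NormedAddCommGroup V] [NormedSpace ℝ V] {H : Type*} [TopologicalSpace H]
  {I : ModelWithCorners ℝ V H} {N : Type*} [TopologicalSpace N] [ChartedSpace H N]

theorem contMDiffAt_U_comp {a : N → ℝ} {m : N → M} {q : N} {k : ℕ∞}
    (ha : ContMDiffAt I 𝓘(ℝ, ℝ) k a q) (hm : ContMDiffAt I (𝓡 3) k m q) :
    ContMDiffAt I (𝓡 3) k (fun q ↦ P.U (a q) (m q)) q :=
  ((P.U_smooth (a q, m q)).of_le (by exact_mod_cast le_top)).comp (f := fun q ↦ (a q, m q)) q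
    (ha.prodMk hm)

/-- Varying the angle moves along the orbit with velocity `T`, by `U_flow`. The angle is real-valued
because smoothness of the action is expressed on `ℝ × M`. -/
theorem mfderiv_U_comp {a : N → ℝ} {m : N → M} {q : N} (ha : MDifferentiableAt I 𝓘(ℝ, ℝ) a q)
    (hm : MDifferentiableAt I (𝓡 3) m q) (v : TangentSpace I q) :
    mfderiv I (𝓡 3) (fun q ↦ P.U (a q) (m q)) q v =
      (show ℝ from mfderiv I 𝓘(ℝ, ℝ) a q v) • P.T (P.U (a q) (m q)) +
        mfderiv (𝓡 3) (𝓡 3) (P.U (a q)) (m q) (mfderiv I (𝓡 3) m q v) := by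
  have hU : MDifferentiableAt (𝓘(ℝ, ℝ).prod (𝓡 3)) (𝓡 3)
      (fun z : ℝ × M ↦ P.U (z.1 : Real.Angle) z.2) (a q, m q) :=
    (P.U_smooth _).mdifferentiableAt (by simp)
  have h1 := mfderiv_comp_apply (f := fun q ↦ (a q, m q)) q hU (ha.prodMk hm) v
  have h2 := mfderiv_prod_eq_add_apply (v := mfderiv I (𝓘(ℝ, ℝ).prod (𝓡 3))
    (fun q ↦ (a q, m q)) q v) hU
  have h3 := (P.U_flow (m q) (a q)).mfderiv
  rw [mfderiv_prodMk ha hm] at h1 h2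
  refine h1.trans (h2.trans ?_)
  rw [show mfderiv 𝓘(ℝ, ℝ) (𝓡 3) (fun t : ℝ ↦ P.U t (m q)) (a q) = _ from h3]
  rfl

end Curves

theorem isSmooth_η : P.η.IsSmooth := P.η_smooth

/-- The contact form is invariant under the circle action. -/
theorem η_mfderiv_U (θ : Real.Angle) (x : M) (v : TangentSpace (𝓡 3) x) :
    P.η (P.U θ x) (mfderiv (𝓡 3) (𝓡 3) (P.U θ) x v) = P.η x v := by
  set φ := extChartAt (𝓡 3) x with hφ
  -- Cartan's formula in flow coordinates: `H^* η` is `1` on the time direction, and its exterior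
  -- derivative kills that direction because `T ⌟ dη = 0`. Its spatial coefficients are thus
  -- constant in time, and at time `0` the map `U` is the identity.
  let H : ℝ × EuclideanSpace ℝ (Fin 3) → M := fun z ↦ P.U (z.1 : ℝ) (φ.symm z.2)
  have htarget : ∀ y ∈ φ.target, φ.target ∈ 𝓝 y := fun y hy ↦
    (isOpen_extChartAt_target (I := 𝓡 3) x).mem_nhds hy
  have hsymm : ∀ y ∈ φ.target, ContMDiffAt (𝓡 3) (𝓡 3) ∞ φ.symm y := fun y hy ↦
    (contMDiffOn_extChartAt_symm x).contMDiffAt (htarget y hy)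
  have hsnd : ∀ z : ℝ × EuclideanSpace ℝ (Fin 3), z.2 ∈ φ.target →
      ContMDiffAt 𝓘(ℝ, ℝ × EuclideanSpace ℝ (Fin 3)) (𝓡 3) ∞
        (fun z : ℝ × EuclideanSpace ℝ (Fin 3) ↦ φ.symm z.2) z := fun z hz ↦
    (hsymm z.2 hz).comp z contDiff_snd.contMDiff.contMDiffAt
  have hfst : ContMDiff 𝓘(ℝ, ℝ × EuclideanSpace ℝ (Fin 3)) 𝓘(ℝ, ℝ) ∞
      (fun z : ℝ × EuclideanSpace ℝ (Fin 3) ↦ z.1) := contDiff_fst.contMDiff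
  have hH : ∀ z : ℝ × EuclideanSpace ℝ (Fin 3), z.2 ∈ φ.target →
      ContMDiffAt 𝓘(ℝ, ℝ × EuclideanSpace ℝ (Fin 3)) (𝓡 3) ∞ H z := fun z hz ↦
    P.contMDiffAt_U_comp (k := ⊤) hfst.contMDiffAt (hsnd z hz)
  have hDH : ∀ z : ℝ × EuclideanSpace ℝ (Fin 3), z.2 ∈ φ.target → ∀ w,
      mfderiv 𝓘(ℝ, ℝ × EuclideanSpace ℝ (Fin 3)) (𝓡 3) H z w = w.1 • P.T (H z) +
        mfderiv (𝓡 3) (𝓡 3) (P.U z.1) (φ.symm z.2) (mfderiv (𝓡 3) (𝓡 3) φ.symm z.2 w.2) := by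
    intro z hz w
    have h1 := P.mfderiv_U_comp (hfst.contMDiffAt.mdifferentiableAt (x := z) (by simp))
      ((hsnd z hz).mdifferentiableAt (by simp)) w
    refine h1.trans ?_
    have h2 : mfderiv 𝓘(ℝ, ℝ × EuclideanSpace ℝ (Fin 3)) (𝓡 3)
        (fun z : ℝ × EuclideanSpace ℝ (Fin 3) ↦ φ.symm z.2) z w =
        mfderiv (𝓡 3) (𝓡 3) φ.symm z.2 w.2 := by
      refine (mfderiv_comp_apply (I' := 𝓡 3) (g := φ.symm)
        (f := fun z : ℝ × EuclideanSpace ℝ (Fin 3) ↦ z.2) z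
        ((hsymm z.2 hz).mdifferentiableAt (by simp)) differentiableAt_snd.mdifferentiableAt w).trans ?_
      rw [mfderiv_eq_fderiv, fderiv_snd]
      rfl
    rw [h2, mfderiv_eq_fderiv, fderiv_fst]
    rfl
  have hDH1 : ∀ z : ℝ × EuclideanSpace ℝ (Fin 3), z.2 ∈ φ.target →
      mfderiv 𝓘(ℝ, ℝ × EuclideanSpace ℝ (Fin 3)) (𝓡 3) H z (((1 : ℝ), (0 : EuclideanSpace ℝ (Fin 3))) :
        ℝ × EuclideanSpace ℝ (Fin 3)) = P.T (H z) := by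
    intro z hz
    refine (hDH z hz _).trans ?_
    change (1 : ℝ) • P.T (H z) + mfderiv (𝓡 3) (𝓡 3) (P.U z.1) (φ.symm z.2)
      (mfderiv (𝓡 3) (𝓡 3) φ.symm z.2 (0 : TangentSpace (𝓡 3) z.2)) = _
    rw [map_zero, map_zero, one_smul, add_zero]
  have hDH2 : ∀ z : ℝ × EuclideanSpace ℝ (Fin 3), z.2 ∈ φ.target → ∀ w : EuclideanSpace ℝ (Fin 3),
      mfderiv 𝓘(ℝ, ℝ × EuclideanSpace ℝ (Fin 3)) (𝓡 3) H z (((0 : ℝ), w) :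
        ℝ × EuclideanSpace ℝ (Fin 3)) = mfderiv (𝓡 3) (𝓡 3) (P.U z.1) (φ.symm z.2)
          (mfderiv (𝓡 3) (𝓡 3) φ.symm z.2 w) := by
    intro z hz w
    refine (hDH z hz _).trans ?_
    change (0 : ℝ) • P.T (H z) + _ = _
    rw [zero_smul, zero_add]
  set y := φ x with hy
  have hyt : y ∈ φ.target := φ.map_source (mem_extChartAt_source x)
  have hconst : ∀ (w : EuclideanSpace ℝ (Fin 3)) (t : ℝ),
      pullForm P.η H (t, y) (0, w) = pullForm P.η H (0, y) (0, w) := by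
    intro w t
    refine apply_snd_eq_of_extDer_eq_zero (c := 1) (fun t ↦ ?_) (fun t ↦ ?_) w (fun t ↦ ?_) t
    · exact (contDiffAt_pullForm (m := 1) (k := ⊤) P.isSmooth_η (hH (t, y) hyt)
        (by simp)).differentiableAt (by simp)
    · have : ∀ᶠ z : ℝ × EuclideanSpace ℝ (Fin 3) in 𝓝 (t, y), z.2 ∈ φ.target :=
        continuous_snd.continuousAt.eventually (htarget y hyt)
      filter_upwards [this] with z hz
      exact (congrArg (P.η (H z)) (hDH1 z hz)).trans (P.η_T _)
    · have h1 := extDer_pullForm P.isSmooth_η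
        ((hH (t, y) hyt).of_le (by norm_cast)) (1, 0) (0, w)
      refine h1.trans ?_
      rw [hDH1 (t, y) hyt]
      exact P.dη_T _ _
  have hval : ∀ (t : ℝ) (w : EuclideanSpace ℝ (Fin 3)), pullForm P.η H (t, y) (0, w) =
      P.η (P.U t (φ.symm y)) (mfderiv (𝓡 3) (𝓡 3) (P.U t) (φ.symm y)
        (mfderiv (𝓡 3) (𝓡 3) φ.symm y w)) :=
    fun t w ↦ congrArg (P.η (H (t, y))) (hDH2 (t, y) hyt w)
  have hid : ∀ (g : M → M) (x : M) (v : TangentSpace (𝓡 3) x), g = id →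
      P.η (g x) (mfderiv (𝓡 3) (𝓡 3) g x v) = P.η x v := by
    rintro _ x v rfl
    rw [mfderiv_id]
    rfl
  have hgen : ∀ (t : ℝ) (w : EuclideanSpace ℝ (Fin 3)) (x' : M) (v' : EuclideanSpace ℝ (Fin 3)),
      φ.symm y = x' → mfderiv (𝓡 3) (𝓡 3) φ.symm y w = v' →
      P.η (P.U t x') (mfderiv (𝓡 3) (𝓡 3) (P.U t) x' v') = P.η x' v' := by
    rintro t w _ _ rfl rfl
    have h0 : P.U ((0 : ℝ) : Real.Angle) = id := by
      funext x
      rw [Real.Angle.coe_zero]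
      exact P.U_zero x
    exact (hval t w).symm.trans ((hconst w t).trans ((hval 0 w).trans (hid _ _ _ h0)))
  obtain ⟨t, rfl⟩ : ∃ t : ℝ, (t : Real.Angle) = θ := QuotientAddGroup.mk_surjective θ
  exact hgen t _ x v (φ.left_inv (mem_extChartAt_source x))
    (mfderiv_extChartAt_symm_apply (mem_extChartAt_source x) v)

end ContactCircleBundle

/-! ### Right inverses from the inverse function theorem. -/

section InverseFunction

open Filter Topology

variable {E E' : Type*} [NormedAddCommGroup E] [NormedSpace ℝ E] [FiniteDimensional ℝ E]
  [NormedAddCommGroup E'] [NormedSpace ℝ E'] [FiniteDimensional ℝ E']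

/-- A regular right inverse of a map whose derivative is bijective. -/
theorem exists_rightInverse_of_fderiv_injective {f : E → E'} {a : E} {k : WithTop ℕ∞} (hk : k ≠ 0)
    (hf : ContDiffAt ℝ k f a) (hinj : Function.Injective (fderiv ℝ f a))
    (hrank : Module.finrank ℝ E = Module.finrank ℝ E') :
    ∃ g : E' → E, g (f a) = a ∧ ContDiffAt ℝ k g (f a) ∧ ∀ᶠ y in 𝓝 (f a), f (g y) = y := by
  have : CompleteSpace E := FiniteDimensional.complete ℝ E
  let e : E ≃L[ℝ] E' := (LinearEquiv.ofInjectiveOfFinrankEq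
    (fderiv ℝ f a : E →ₗ[ℝ] E') hinj hrank).toContinuousLinearEquiv
  have he : HasFDerivAt f (e : E →L[ℝ] E') a := by
    convert! (hf.differentiableAt hk).hasFDerivAt
  have hs := hf.hasStrictFDerivAt' he hk
  exact ⟨hf.localInverse he hk, hf.localInverse_apply_image he hk, hf.to_localInverse he hk,
    hs.eventually_right_inverse⟩

omit [FiniteDimensional ℝ E] in
/-- A regular right inverse of a map whose derivative is surjective. -/
theorem exists_rightInverse_of_fderiv_surjective {f : E → E'} {a : E} {k : WithTop ℕ∞} (hk : k ≠ 0)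
    (hf : ContDiffAt ℝ k f a) (hsurj : Function.Surjective (fderiv ℝ f a)) :
    ∃ g : E' → E, g (f a) = a ∧ ContDiffAt ℝ k g (f a) ∧ ∀ᶠ y in 𝓝 (f a), f (g y) = y := by
  obtain ⟨B, hB⟩ := (fderiv ℝ f a : E →ₗ[ℝ] E').exists_rightInverse_of_surjective
    (LinearMap.range_eq_top.2 hsurj)
  let B' : E' →L[ℝ] E := LinearMap.toContinuousLinearMap B
  -- An affine slice through `a` in the direction of a linear right inverse of the derivative.
  -- Restricted to it, `f` has derivative the identity, which reduces the surjective case to the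
  -- bijective one.
  let i : E' → E := fun z ↦ a + B' (z - f a)
  have hia : i (f a) = a := by simp [i]
  have hi : HasFDerivAt i B' (f a) :=
    (B'.hasFDerivAt.comp (f a) ((hasFDerivAt_id _).sub_const (f a))).const_add a
  have hic : ContDiff ℝ k i := contDiff_const.add (B'.contDiff.comp (contDiff_id.sub contDiff_const))
  have hfi : ContDiffAt ℝ k (f ∘ i) (f a) :=
    ContDiffAt.comp (f a) (by rwa [hia]) hic.contDiffAt
  have hd : fderiv ℝ (f ∘ i) (f a) = ContinuousLinearMap.id ℝ E' := by
    have h1 : HasFDerivAt f (fderiv ℝ f a) (i (f a)) := by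
      rw [hia]; exact (hf.differentiableAt hk).hasFDerivAt
    rw [(h1.comp (f a) hi).fderiv]
    ext1 z
    exact LinearMap.congr_fun hB z
  obtain ⟨g, hg1, hg2, hg3⟩ := exists_rightInverse_of_fderiv_injective hk hfi
    (by rw [hd]; exact Function.injective_id) rfl
  simp only [Function.comp_apply, hia] at hg1 hg2 hg3
  exact ⟨i ∘ g, by simp [hg1, hia], hic.contDiffAt.comp _ hg2, hg3⟩

end InverseFunction

/-- The ascription to the model space makes the two sides comparable, although they formally lie in
the tangent spaces at `f q` and `g q`. -/
theorem mfderiv_apply_congr {V : Type*} [NormedAddCommGroup V] [NormedSpace ℝ V] {H : Type*}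
    [TopologicalSpace H] {I : ModelWithCorners ℝ V H} {N : Type*} [TopologicalSpace N]
    [ChartedSpace H N] {n : ℕ} {X : Type*} [TopologicalSpace X]
    [ChartedSpace (EuclideanSpace ℝ (Fin n)) X] {f g : N → X} {q : N} (h : f =ᶠ[nhds q] g)
    (v : TangentSpace I q) :
    (mfderiv I (𝓡 n) f q v : EuclideanSpace ℝ (Fin n)) = mfderiv I (𝓡 n) g q v :=
  congrArg (fun L : TangentSpace I q →L[ℝ] EuclideanSpace ℝ (Fin n) ↦ L v) h.mfderiv_eq

theorem contMDiffAt_extChartAt_symm {n : ℕ} {X : Type*} [TopologicalSpace X]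
    [ChartedSpace (EuclideanSpace ℝ (Fin n)) X] [IsManifold (𝓡 n) ∞ X] {x : X}
    {y : EuclideanSpace ℝ (Fin n)} (hy : y ∈ (extChartAt (𝓡 n) x).target) :
    ContMDiffAt (𝓡 n) (𝓡 n) ∞ (extChartAt (𝓡 n) x).symm y :=
  (contMDiffOn_extChartAt_symm x).contMDiffAt ((isOpen_extChartAt_target (I := 𝓡 n) x).mem_nhds hy)

/-! ### Local sections, local angles and local triviality. -/

namespace ContactCircleBundle

open Filter Topology

variable {M : Type*} [TopologicalSpace M] [ChartedSpace (EuclideanSpace ℝ (Fin 3)) M]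
  [IsManifold (𝓡 3) ∞ M] {S : Type*} [TopologicalSpace S]
  [ChartedSpace (EuclideanSpace ℝ (Fin 2)) S] [IsManifold (𝓡 2) ∞ S]
  (P : ContactCircleBundle M S)

/-- The contact form on the velocity of a rotated map. -/
theorem η_mfderiv_U_comp {V : Type*} [NormedAddCommGroup V] [NormedSpace ℝ V] {H : Type*}
    [TopologicalSpace H] {I : ModelWithCorners ℝ V H} {N : Type*} [TopologicalSpace N]
    [ChartedSpace H N] {a : N → ℝ} {m : N → M} {q : N} (ha : MDifferentiableAt I 𝓘(ℝ, ℝ) a q)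
    (hm : MDifferentiableAt I (𝓡 3) m q) (v : TangentSpace I q) :
    P.η (P.U (a q) (m q)) (mfderiv I (𝓡 3) (fun q ↦ P.U (a q) (m q)) q v) =
      (show ℝ from mfderiv I 𝓘(ℝ, ℝ) a q v) + P.η (m q) (mfderiv I (𝓡 3) m q v) := by
  rw [P.mfderiv_U_comp ha hm, map_add, map_smul, P.η_T, P.η_mfderiv_U]
  exact congrArg (· + _) (mul_one _)

/-- Existence of regular local sections of the projection. -/
theorem exists_section_at (x₀ : M) :
    ∃ s : S → M, s (P.p x₀) = x₀ ∧ ContMDiffAt (𝓡 2) (𝓡 3) 2 s (P.p x₀) ∧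
      ∀ᶠ q in 𝓝 (P.p x₀), P.p (s q) = q := by
  set φ := extChartAt (𝓡 3) x₀ with hφ
  set q₀ := P.p x₀ with hq₀
  set ψ := extChartAt (𝓡 2) q₀ with hψ
  have hx₀ : φ x₀ ∈ φ.target := φ.map_source (mem_extChartAt_source x₀)
  have hsymm : φ.symm (φ x₀) = x₀ := φ.left_inv (mem_extChartAt_source x₀)
  have hφs : ContMDiffAt (𝓡 3) (𝓡 3) ∞ φ.symm (φ x₀) := contMDiffAt_extChartAt_symm hx₀
  have hψc : ContMDiffAt (𝓡 2) (𝓡 2) ∞ ψ q₀ := contMDiffAt_extChartAt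
  have hψp : ContMDiffAt (𝓡 3) (𝓡 2) ∞ (ψ ∘ P.p) x₀ := hψc.comp x₀ (P.p_smooth x₀)
  have hf : ContMDiffAt (𝓡 3) (𝓡 2) ∞ ((ψ ∘ P.p) ∘ φ.symm) (φ x₀) :=
    ContMDiffAt.comp (φ x₀) (by rwa [hsymm]) hφs
  -- Order two is what `extDer_pullForm` requires of a section. Being finite, it also spreads from a
  -- point to a neighbourhood.
  have hf' : ContDiffAt ℝ 2 ((ψ ∘ P.p) ∘ φ.symm) (φ x₀) := hf.contDiffAt.of_le (by norm_cast)
  have hfx : ((ψ ∘ P.p) ∘ φ.symm) (φ x₀) = ψ q₀ := by simp [hsymm, hq₀]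
  have hpψ : MDifferentiableAt (𝓡 2) (𝓡 2) ψ q₀ := hψc.mdifferentiableAt (by simp)
  have hsurj : Function.Surjective (fderiv ℝ ((ψ ∘ P.p) ∘ φ.symm) (φ x₀)) := by
    intro z
    have hψs : ∀ w : EuclideanSpace ℝ (Fin 2), ∃ w' : TangentSpace (𝓡 2) q₀,
        mfderiv (𝓡 2) (𝓡 2) ψ q₀ w' = w :=
      fun w ↦ ⟨w, by rw [hψ, mfderiv_extChartAt_self]; rfl⟩
    obtain ⟨w, hw⟩ := hψs z
    obtain ⟨v, hv⟩ := P.p_submersion x₀ w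
    refine ⟨mfderiv (𝓡 3) (𝓡 3) φ x₀ v, ?_⟩
    rw [← mfderiv_eq_fderiv]
    have h1 : mfderiv (𝓡 3) (𝓡 2) (((ψ ∘ P.p) ∘ φ.symm) ∘ φ) x₀ v =
        mfderiv (𝓡 3) (𝓡 2) ((ψ ∘ P.p) ∘ φ.symm) (φ x₀) (mfderiv (𝓡 3) (𝓡 3) φ x₀ v) :=
      mfderiv_comp_apply x₀ (hf.mdifferentiableAt (by simp))
        (mdifferentiableAt_extChartAt (mem_chart_source _ _)) v
    have h2 : ((ψ ∘ P.p) ∘ φ.symm) ∘ φ =ᶠ[𝓝 x₀] ψ ∘ P.p := by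
      filter_upwards [extChartAt_source_mem_nhds (I := 𝓡 3) x₀] with y hy
      simp only [Function.comp_apply]
      rw [φ.left_inv hy]
    have h3 : mfderiv (𝓡 3) (𝓡 2) (ψ ∘ P.p) x₀ v =
        mfderiv (𝓡 2) (𝓡 2) ψ q₀ (mfderiv (𝓡 3) (𝓡 2) P.p x₀ v) :=
      mfderiv_comp_apply x₀ hpψ ((P.p_smooth x₀).mdifferentiableAt (by simp)) v
    refine h1.symm.trans ((mfderiv_apply_congr h2 v).trans (h3.trans ?_))
    exact (congrArg (mfderiv (𝓡 2) (𝓡 2) ψ q₀) hv).trans hw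
  obtain ⟨g, hg1, hg2, hg3⟩ := exists_rightInverse_of_fderiv_surjective two_ne_zero hf' hsurj
  rw [hfx] at hg1 hg2 hg3
  have hgψ : ContMDiffAt (𝓡 2) (𝓡 3) 2 (g ∘ ψ) q₀ :=
    hg2.contMDiffAt.comp q₀ (hψc.of_le (by norm_cast))
  have hs : ContMDiffAt (𝓡 2) (𝓡 3) 2 (φ.symm ∘ (g ∘ ψ)) q₀ :=
    ContMDiffAt.comp q₀ (by
      rw [show (g ∘ ψ) q₀ = φ x₀ from hg1]
      exact hφs.of_le (by norm_cast)) hgψ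
  have hsq : (φ.symm ∘ (g ∘ ψ)) q₀ = x₀ := by
    simp only [Function.comp_apply]
    rw [hg1, hsymm]
  refine ⟨φ.symm ∘ (g ∘ ψ), hsq, hs, ?_⟩
  have hps : ContinuousAt (fun q ↦ P.p ((φ.symm ∘ (g ∘ ψ)) q)) q₀ :=
    P.p_smooth.continuous.continuousAt.comp hs.continuousAt
  have h1 := hps.eventually (show ψ.source ∈ 𝓝 (P.p ((φ.symm ∘ (g ∘ ψ)) q₀)) by
    rw [hsq]; exact extChartAt_source_mem_nhds (I := 𝓡 2) q₀)
  filter_upwards [hψc.continuousAt.eventually hg3, h1,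
    extChartAt_source_mem_nhds (I := 𝓡 2) q₀] with q h2 h3 h4
  exact ψ.injOn h3 h4 h2

/-- Regular local sections of the projection are transversal slices of the circle action: they come
with regular local angle functions. -/
theorem exists_angle_at {x₀ : M} {s : S → M} (hsx : s (P.p x₀) = x₀)
    (hs : ContMDiffAt (𝓡 2) (𝓡 3) 2 s (P.p x₀)) (hps : ∀ᶠ q in 𝓝 (P.p x₀), P.p (s q) = q) :
    ∃ τ : M → ℝ, ContMDiffAt (𝓡 3) 𝓘(ℝ, ℝ) 2 τ x₀ ∧ ∀ᶠ x in 𝓝 x₀, P.U (τ x) (s (P.p x)) = x := by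
  set φ := extChartAt (𝓡 3) x₀ with hφ
  set q₀ := P.p x₀ with hq₀
  set ψ := extChartAt (𝓡 2) q₀ with hψ
  have hz₀ : ψ q₀ ∈ ψ.target := ψ.map_source (mem_extChartAt_source q₀)
  have hψq : ψ.symm (ψ q₀) = q₀ := ψ.left_inv (mem_extChartAt_source q₀)
  have hφc : ContMDiffAt (𝓡 3) (𝓡 3) ∞ φ x₀ := contMDiffAt_extChartAt
  have hψc : ContMDiffAt (𝓡 2) (𝓡 2) ∞ ψ q₀ := contMDiffAt_extChartAt
  set e₀ : ℝ × EuclideanSpace ℝ (Fin 2) := (0, ψ q₀) with he₀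
  let I := 𝓘(ℝ, ℝ × EuclideanSpace ℝ (Fin 2))
  let σ : ℝ × EuclideanSpace ℝ (Fin 2) → M := fun e ↦ s (ψ.symm e.2)
  let H : ℝ × EuclideanSpace ℝ (Fin 2) → M := fun e ↦ P.U (e.1 : ℝ) (σ e)
  have hσe : σ e₀ = x₀ := by simp only [σ, he₀, hψq, hsx]
  have hHe : H e₀ = x₀ := by
    simp only [H, hσe]
    rw [he₀, Real.Angle.coe_zero, P.U_zero]
  have hψs : ContMDiffAt I (𝓡 2) 2 (fun e : ℝ × EuclideanSpace ℝ (Fin 2) ↦ ψ.symm e.2) e₀ :=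
    ((contMDiffAt_extChartAt_symm hz₀).of_le (by norm_cast)).comp e₀
      contDiff_snd.contMDiff.contMDiffAt
  have hσ : ContMDiffAt I (𝓡 3) 2 σ e₀ :=
    ContMDiffAt.comp e₀ (by rwa [show ψ.symm e₀.2 = q₀ from hψq]) hψs
  have hfst : ContMDiffAt I 𝓘(ℝ, ℝ) 2 (fun e : ℝ × EuclideanSpace ℝ (Fin 2) ↦ e.1) e₀ :=
    contDiff_fst.contMDiff.contMDiffAt
  have hH : ContMDiffAt I (𝓡 3) 2 H e₀ := P.contMDiffAt_U_comp (k := 2) hfst hσ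
  have hpH : ∀ᶠ e in 𝓝 e₀, P.p (H e) = ψ.symm e.2 := by
    have h1 := hψs.continuousAt.eventually
      (show ∀ᶠ q in 𝓝 (ψ.symm e₀.2), P.p (s q) = q by rwa [show ψ.symm e₀.2 = q₀ from hψq])
    filter_upwards [h1] with e he
    rw [P.p_U]
    exact he
  set Φ : ℝ × EuclideanSpace ℝ (Fin 2) → EuclideanSpace ℝ (Fin 3) := φ ∘ H with hΦ
  have hΦc : ContMDiffAt I (𝓡 3) 2 Φ e₀ :=
    ContMDiffAt.comp e₀ (by rw [hHe]; exact hφc.of_le (by norm_cast)) hH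
  -- The differential of `H` at `e₀` is injective because `p` detects the base component of a vector
  -- and `η`, with `η T = 1`, detects the angular one. The angle function is then the first
  -- component of a local inverse.
  have hinj : Function.Injective (fderiv ℝ Φ e₀) := by
    rw [injective_iff_map_eq_zero]
    rintro w hw
    have hHw : mfderiv I (𝓡 3) H e₀ w = 0 := by
      have h1 : mfderiv I (𝓡 3) Φ e₀ w = mfderiv (𝓡 3) (𝓡 3) φ (H e₀) (mfderiv I (𝓡 3) H e₀ w) :=
        mfderiv_comp_apply e₀ (by rw [hHe]; exact hφc.mdifferentiableAt (by simp))
          (hH.mdifferentiableAt (by simp)) w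
      have h2 : mfderiv I (𝓡 3) Φ e₀ w = 0 := by rw [mfderiv_eq_fderiv]; exact hw
      have h3 := mfderiv_extChartAt_symm_apply (x := x₀) (x' := H e₀)
        (by rw [hHe]; exact mem_extChartAt_source x₀) (mfderiv I (𝓡 3) H e₀ w)
      rw [← hφ, ← h1, h2, map_zero] at h3
      exact h3.symm
    have hpH' : (ψ ∘ P.p) ∘ H =ᶠ[𝓝 e₀] fun e ↦ e.2 := by
      have h1 : ∀ᶠ e : ℝ × EuclideanSpace ℝ (Fin 2) in 𝓝 e₀, e.2 ∈ ψ.target :=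
        continuous_snd.continuousAt.eventually ((isOpen_extChartAt_target (I := 𝓡 2) q₀).mem_nhds hz₀)
      filter_upwards [hpH, h1] with e h2 h3
      simp only [Function.comp_apply]
      rw [h2, ψ.right_inv h3]
    have hw2 : w.2 = 0 := by
      have h1 : mfderiv I (𝓡 2) ((ψ ∘ P.p) ∘ H) e₀ w =
          mfderiv (𝓡 3) (𝓡 2) (ψ ∘ P.p) (H e₀) (mfderiv I (𝓡 3) H e₀ w) :=
        mfderiv_comp_apply e₀ (by
          rw [hHe]
          exact (hψc.comp x₀ (P.p_smooth x₀)).mdifferentiableAt (by simp))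
          (hH.mdifferentiableAt (by simp)) w
      rw [hHw, map_zero] at h1
      have h2 : mfderiv I (𝓡 2) (fun e : ℝ × EuclideanSpace ℝ (Fin 2) ↦ e.2) e₀ w = w.2 := by
        rw [mfderiv_eq_fderiv, fderiv_snd]
        rfl
      exact h2.symm.trans ((mfderiv_apply_congr hpH' w).symm.trans h1)
    have hσw : mfderiv I (𝓡 3) σ e₀ w = 0 := by
      have h1 : mfderiv I (𝓡 3) ((s ∘ ψ.symm) ∘ Prod.snd) e₀ w =
          mfderiv (𝓡 2) (𝓡 3) (s ∘ ψ.symm) e₀.2 (mfderiv I (𝓡 2) Prod.snd e₀ w) :=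
        mfderiv_comp_apply e₀ (by
          refine ContMDiffAt.mdifferentiableAt (n := 2) (ContMDiffAt.comp _ ?_
            ((contMDiffAt_extChartAt_symm hz₀).of_le (by norm_cast))) (by simp)
          rwa [hψq]) differentiableAt_snd.mdifferentiableAt w
      have h2 : mfderiv I (𝓡 2) (Prod.snd : ℝ × EuclideanSpace ℝ (Fin 2) → _) e₀ w = 0 := by
        rw [mfderiv_eq_fderiv, fderiv_snd]
        exact hw2
      rw [h2, map_zero] at h1
      exact h1
    have hw1 : w.1 = 0 := by
      have h1 := P.η_mfderiv_U_comp (hfst.mdifferentiableAt (by simp))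
        (hσ.mdifferentiableAt (by simp)) w
      rw [hσw, map_zero, add_zero, mfderiv_eq_fderiv, fderiv_fst] at h1
      have h2 : (P.η (H e₀)) (mfderiv I (𝓡 3) H e₀ w) = 0 := by rw [hHw, map_zero]
      exact h1.symm.trans h2
    exact Prod.ext hw1 hw2
  obtain ⟨g, hg1, hg2, hg3⟩ := exists_rightInverse_of_fderiv_injective two_ne_zero hΦc.contDiffAt
    hinj (by simp [Module.finrank_prod])
  have hΦe : Φ e₀ = φ x₀ := by simp only [hΦ, Function.comp_apply, hHe]
  rw [hΦe] at hg1 hg2 hg3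
  have hgφ : ContMDiffAt (𝓡 3) I 2 (g ∘ φ) x₀ :=
    hg2.contMDiffAt.comp x₀ (hφc.of_le (by norm_cast))
  have hgφe : (g ∘ φ) x₀ = e₀ := hg1
  refine ⟨fun x ↦ (g (φ x)).1, contDiff_fst.contMDiff.contMDiffAt.comp x₀ hgφ, ?_⟩
  have hHg : ContinuousAt (fun x ↦ H ((g ∘ φ) x)) x₀ :=
    ContinuousAt.comp (g := H) (f := g ∘ φ) (by rw [hgφe]; exact hH.continuousAt) hgφ.continuousAt
  have h1 := hHg.eventually (show φ.source ∈ 𝓝 (H ((g ∘ φ) x₀)) by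
    rw [hgφe, hHe]; exact extChartAt_source_mem_nhds (I := 𝓡 3) x₀)
  have h2 := hgφ.continuousAt.eventually (show ∀ᶠ e in 𝓝 ((g ∘ φ) x₀), P.p (H e) = ψ.symm e.2 by
    rwa [hgφe])
  filter_upwards [hφc.continuousAt.eventually hg3, h1, h2,
    extChartAt_source_mem_nhds (I := 𝓡 3) x₀] with x h3 h4 h5 h6
  have h7 : H (g (φ x)) = x := φ.injOn h4 h6 h3
  have h8 : P.p x = ψ.symm (g (φ x)).2 := (congrArg P.p h7).symm.trans h5
  rw [h8]
  exact h7

/-- Local triviality of a contact circle bundle. -/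
theorem exists_local_section (x₀ : M) :
    ∃ W : Set S, IsOpen W ∧ P.p x₀ ∈ W ∧ ∃ s : S → M, s (P.p x₀) = x₀ ∧
      (∀ q ∈ W, ContMDiffAt (𝓡 2) (𝓡 3) 2 s q ∧ P.p (s q) = q) ∧
      ∀ x, P.p x ∈ W → ∃ τ : M → ℝ, ContMDiffAt (𝓡 3) 𝓘(ℝ, ℝ) 2 τ x ∧
        ∀ᶠ y in 𝓝 x, P.U (τ y) (s (P.p y)) = y := by
  obtain ⟨s, hsx, hs, hps⟩ := P.exists_section_at x₀
  obtain ⟨τ, hτ, hτU⟩ := P.exists_angle_at hsx hs hps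
  have : IsManifold (𝓡 3) 2 M := .of_le (n := ∞) (by norm_cast)
  have : IsManifold (𝓡 2) 2 S := .of_le (n := ∞) (by norm_cast)
  have hτ' := (contMDiffAt_iff_contMDiffAt_nhds (by norm_cast)).1 hτ
  have hs' := (contMDiffAt_iff_contMDiffAt_nhds (by norm_cast)).1 hs
  obtain ⟨O, hO, hOopen, hxO⟩ := mem_nhds_iff.1 (hτ'.and hτU)
  -- `W` is shrunk so that the section stays in the domain `O` of the angle function; rotations then
  -- reach every point over `W`.
  have hsO : ∀ᶠ q in 𝓝 (P.p x₀), s q ∈ O :=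
    hs.continuousAt.eventually (hOopen.mem_nhds (by rwa [hsx]))
  obtain ⟨W, hW, hWopen, hxW⟩ := mem_nhds_iff.1 ((hs'.and hps).and hsO)
  refine ⟨W, hWopen, hxW, s, hsx, fun q hq ↦ (hW hq).1, fun x hx ↦ ?_⟩
  obtain ⟨θ, hθ⟩ := (P.p_eq_iff (s (P.p x)) x).1 (hW hx).1.2
  obtain ⟨t, rfl⟩ : ∃ t : ℝ, (t : Real.Angle) = θ := QuotientAddGroup.mk_surjective θ
  have hmem : P.U (-(t : Real.Angle)) x ∈ O := by
    rw [← hθ, P.U_neg]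
    exact (hW hx).2
  have hUc := P.contMDiff_U (-(t : Real.Angle))
  -- The fibres are circles, so a real-valued angle is only sought near each point `x`. It is
  -- obtained by rotating `x` back to the section and adding the rotation angle `t`.
  refine ⟨fun y ↦ t + τ (P.U (-(t : Real.Angle)) y), ?_, ?_⟩
  · exact contMDiffAt_const.add
      (ContMDiffAt.comp x (hO hmem).1 ((hUc x).of_le (by norm_cast)))
  · filter_upwards [hUc.continuous.continuousAt.eventually (hOopen.mem_nhds hmem)] with y hy
    have := (hO hy).2
    rw [P.p_U] at this
    rw [Real.Angle.coe_add, P.U_add, this, P.U_neg']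

end ContactCircleBundle

/-- Every tangent space unfolds to the model space. Typing the vectors there allows the base point
to be rewritten without transport. -/
theorem OneForm.apply_congr {n : ℕ} {X : Type*} [TopologicalSpace X]
    [ChartedSpace (EuclideanSpace ℝ (Fin n)) X] (α : OneForm n X) {x x' : X} (h : x = x')
    {v v' : EuclideanSpace ℝ (Fin n)} (hv : v = v') : α x v = α x' v' := by
  subst h hv
  rfl

theorem BilinField.apply_congr {n : ℕ} {X : Type*} [TopologicalSpace X]
    [ChartedSpace (EuclideanSpace ℝ (Fin n)) X] (B : BilinField n X) {x x' : X} (h : x = x')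
    {v v' w w' : EuclideanSpace ℝ (Fin n)} (hv : v = v') (hw : w = w') : B x v w = B x' v' w' := by
  subst h hv hw
  rfl

/-- Pulling back a `1`-form to a chart domain. -/
theorem pullForm_comp_extChartAt_symm {n k : ℕ} {X Y : Type*} [TopologicalSpace X]
    [ChartedSpace (EuclideanSpace ℝ (Fin n)) X] [TopologicalSpace Y]
    [ChartedSpace (EuclideanSpace ℝ (Fin k)) Y] [IsManifold (𝓡 k) ∞ Y] (α : OneForm n X)
    {m : Y → X} {y q : Y} (hq : q ∈ (extChartAt (𝓡 k) y).source)
    (hm : MDifferentiableAt (𝓡 k) (𝓡 n) m q) (w : TangentSpace (𝓡 k) q) :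
    pullForm α (m ∘ (extChartAt (𝓡 k) y).symm) (extChartAt (𝓡 k) y q)
      (mfderiv (𝓡 k) (𝓡 k) (extChartAt (𝓡 k) y) q w) = α (m q) (mfderiv (𝓡 k) (𝓡 n) m q w) := by
  have : IsManifold (𝓡 k) 1 Y := .of_le (n := ∞) (by simp)
  set ψ := extChartAt (𝓡 k) y
  have hψq : ψ.symm (ψ q) = q := ψ.left_inv hq
  have h1 : mfderiv (𝓡 k) (𝓡 n) ((m ∘ ψ.symm) ∘ ψ) q w =
      mfderiv (𝓡 k) (𝓡 n) (m ∘ ψ.symm) (ψ q) (mfderiv (𝓡 k) (𝓡 k) ψ q w) := by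
    refine mfderiv_comp_apply q (MDifferentiableAt.comp (ψ q) (by rwa [hψq]) ?_)
      (mdifferentiableAt_extChartAt (by simpa [ψ] using hq)) w
    exact (contMDiffAt_extChartAt_symm (ψ.map_source hq)).mdifferentiableAt (by simp)
  have h2 : (m ∘ ψ.symm) ∘ ψ =ᶠ[nhds q] m := by
    filter_upwards [(isOpen_extChartAt_source (I := 𝓡 k) y).mem_nhds hq] with z hz
    simp only [Function.comp_apply]
    rw [ψ.left_inv hz]
  exact α.apply_congr (by simp only [Function.comp_apply, hψq])
    (h1.symm.trans (mfderiv_apply_congr h2 w))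

/-! ### The local primitive measuring the change of section. -/

namespace ContactCircleBundle

open Filter Topology

variable {M : Type*} [TopologicalSpace M] [ChartedSpace (EuclideanSpace ℝ (Fin 3)) M]
  [IsManifold (𝓡 3) ∞ M] {S : Type*} [TopologicalSpace S]
  [ChartedSpace (EuclideanSpace ℝ (Fin 2)) S] [IsManifold (𝓡 2) ∞ S]
  (P : ContactCircleBundle M S)

/-- Along local sections the curvature of the contact form is the area form. -/
theorem extDer_pullForm_section {E : Type*} [NormedAddCommGroup E] [NormedSpace ℝ E]
    [FiniteDimensional ℝ E] {s : S → M} {c : E → S} {e : E}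
    (hs : ContMDiffAt (𝓡 2) (𝓡 3) 2 s (c e)) (hps : ∀ᶠ q in 𝓝 (c e), P.p (s q) = q)
    (hc : ContMDiffAt 𝓘(ℝ, E) (𝓡 2) 2 c e) (u v : E) :
    extDer (pullForm P.η (s ∘ c)) e u v =
      P.area (c e) (mfderiv 𝓘(ℝ, E) (𝓡 2) c e u) (mfderiv 𝓘(ℝ, E) (𝓡 2) c e v) := by
  have hsc : ContMDiffAt 𝓘(ℝ, E) (𝓡 3) 2 (s ∘ c) e := hs.comp e hc
  rw [extDer_pullForm P.isSmooth_η hsc, P.dη_eq]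
  have h1 : P.p ∘ (s ∘ c) =ᶠ[𝓝 e] c := hc.continuousAt.eventually hps
  have h2 : ∀ w : E, (mfderiv (𝓡 3) (𝓡 2) P.p ((s ∘ c) e) (mfderiv 𝓘(ℝ, E) (𝓡 3) (s ∘ c) e w) :
      EuclideanSpace ℝ (Fin 2)) = mfderiv 𝓘(ℝ, E) (𝓡 2) c e w := fun w ↦
    (mfderiv_comp_apply e ((P.p_smooth _).mdifferentiableAt (by simp))
      (hsc.mdifferentiableAt (by simp)) w).symm.trans (mfderiv_apply_congr h1 w)
  exact P.area.apply_congr hps.self_of_nhds (h2 u) (h2 v)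

/-- For an area preserving `C¹` map `F` and local sections `s`, `s'` the forms `s^* η` and
`(s' ∘ F)^* η` differ locally by an exact form. -/
theorem exists_primitive {F : S → S} (hF : ContMDiff (𝓡 2) (𝓡 2) 1 F)
    (hFa : PreservesArea P.area F) {q₀ : S} {s s' : S → M}
    (hs : ContMDiffAt (𝓡 2) (𝓡 3) 2 s q₀) (hps : ∀ᶠ q in 𝓝 q₀, P.p (s q) = q)
    (hs' : ContMDiffAt (𝓡 2) (𝓡 3) 2 s' (F q₀)) (hps' : ∀ᶠ q in 𝓝 (F q₀), P.p (s' q) = q) :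
    ∃ h : S → ℝ, ∀ᶠ q in 𝓝 q₀, ContMDiffAt (𝓡 2) 𝓘(ℝ, ℝ) 1 h q ∧
      ∀ w : TangentSpace (𝓡 2) q, mfderiv (𝓡 2) 𝓘(ℝ, ℝ) h q w =
        P.η (s q) (mfderiv (𝓡 2) (𝓡 3) s q w) -
          P.η (s' (F q)) (mfderiv (𝓡 2) (𝓡 3) (s' ∘ F) q w) := by
  have : IsManifold (𝓡 3) 2 M := .of_le (n := ∞) (by norm_cast)
  have : IsManifold (𝓡 2) 2 S := .of_le (n := ∞) (by norm_cast)
  have : IsManifold (𝓡 2) 1 S := .of_le (n := ∞) (by norm_cast)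
  set ψ := extChartAt (𝓡 2) q₀ with hψ
  set ψ' := extChartAt (𝓡 2) (F q₀) with hψ'
  set z₀ := ψ q₀ with hz₀
  have hz₀t : ψ.target ∈ 𝓝 z₀ := extChartAt_target_mem_nhds (I := 𝓡 2) q₀
  have hψq : ψ.symm z₀ = q₀ := ψ.left_inv (mem_extChartAt_source q₀)
  have hψc : ContinuousAt ψ.symm z₀ :=
    (contMDiffAt_extChartAt_symm (mem_of_mem_nhds hz₀t)).continuousAt
  set G : EuclideanSpace ℝ (Fin 2) → EuclideanSpace ℝ (Fin 2) := ψ' ∘ (F ∘ ψ.symm) with hG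
  -- From here on `G`, which is `F` read in the charts `ψ` and `ψ'`, takes the role of the `C¹` map
  -- in the Poincaré lemma.
  have hFψ : ∀ z ∈ ψ.target, ContMDiffAt (𝓡 2) (𝓡 2) 1 (F ∘ ψ.symm) z := fun z hz ↦
    (hF _).comp z ((contMDiffAt_extChartAt_symm hz).of_le (by norm_cast))
  have hz₀F : (F ∘ ψ.symm) z₀ = F q₀ := by simp only [Function.comp_apply, hψq]
  have hGz : G z₀ = ψ' (F q₀) := by simp only [hG, Function.comp_apply, hψq]
  have hψ'z : ψ'.symm (ψ' (F q₀)) = F q₀ := ψ'.left_inv (mem_extChartAt_source (F q₀))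
  have hFψs : ∀ᶠ z in 𝓝 z₀, (F ∘ ψ.symm) z ∈ ψ'.source :=
    (hFψ z₀ (mem_of_mem_nhds hz₀t)).continuousAt.eventually (by
      rw [hz₀F]; exact extChartAt_source_mem_nhds (I := 𝓡 2) (F q₀))
  have hGc : ∀ᶠ z in 𝓝 z₀, ContMDiffAt (𝓡 2) (𝓡 2) 1 G z := by
    filter_upwards [hFψs, hz₀t] with z hz hzt
    exact ContMDiffAt.comp z (contMDiffAt_extChartAt' (by simpa [ψ'] using hz)) (hFψ z hzt)
  have hGF : ∀ᶠ z in 𝓝 z₀, ψ'.symm ∘ G =ᶠ[𝓝 z] F ∘ ψ.symm := by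
    filter_upwards [hFψs.eventually_nhds] with z hz
    filter_upwards [hz] with y hy using ψ'.left_inv hy
  have hsev := ((contMDiffAt_iff_contMDiffAt_nhds (by norm_cast)).1 hs).and hps.eventually_nhds
  have hsev' := ((contMDiffAt_iff_contMDiffAt_nhds (by norm_cast)).1 hs').and hps'.eventually_nhds
  have hsz := hψc.eventually (by rw [hψq]; exact hsev)
  have hFc : ContinuousAt (F ∘ ψ.symm) z₀ := (hFψ z₀ (mem_of_mem_nhds hz₀t)).continuousAt
  have hsz' := hFc.eventually (by rw [hz₀F]; exact hsev')
  -- the forms in the charts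
  have hA : ContDiffAt ℝ 1 (pullForm P.η (s ∘ ψ.symm)) z₀ := by
    refine contDiffAt_pullForm (m := 1) (k := 2) P.isSmooth_η (ContMDiffAt.comp z₀ ?_
      ((contMDiffAt_extChartAt_symm (mem_of_mem_nhds hz₀t)).of_le (by norm_cast))) (by norm_cast)
    rw [hψq]
    exact hs
  have hA' : ContDiffAt ℝ 1 (pullForm P.η (s' ∘ ψ'.symm)) (G z₀) := by
    rw [hGz]
    refine contDiffAt_pullForm (m := 1) (k := 2) P.isSmooth_η (ContMDiffAt.comp _ ?_
      ((contMDiffAt_extChartAt_symm (mem_extChartAt_target (F q₀))).of_le (by norm_cast)))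
      (by norm_cast)
    rw [hψ'z]
    exact hs'
  have hG1 : ContDiffAt ℝ 1 G z₀ := hGc.self_of_nhds.contDiffAt
  have hGt : ∀ᶠ z in 𝓝 z₀, G z ∈ ψ'.target := by
    filter_upwards [hFψs] with z hz using ψ'.map_source hz
  have hmGF : ∀ᶠ z in 𝓝 z₀, ∀ u : EuclideanSpace ℝ (Fin 2),
      (mfderiv (𝓡 2) (𝓡 2) ψ'.symm (G z) (fderiv ℝ G z u) : EuclideanSpace ℝ (Fin 2)) =
        mfderiv (𝓡 2) (𝓡 2) F (ψ.symm z) (mfderiv (𝓡 2) (𝓡 2) ψ.symm z u) := by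
    filter_upwards [hGF, hGc, hGt, hz₀t] with z h1 h2 h3 h4 u
    rw [← mfderiv_eq_fderiv]
    have e1 : mfderiv (𝓡 2) (𝓡 2) (ψ'.symm ∘ G) z u =
        mfderiv (𝓡 2) (𝓡 2) ψ'.symm (G z) (mfderiv (𝓡 2) (𝓡 2) G z u) :=
      mfderiv_comp_apply z ((contMDiffAt_extChartAt_symm h3).mdifferentiableAt (by simp))
        (h2.mdifferentiableAt (by simp)) u
    have e2 : mfderiv (𝓡 2) (𝓡 2) (F ∘ ψ.symm) z u =
        mfderiv (𝓡 2) (𝓡 2) F (ψ.symm z) (mfderiv (𝓡 2) (𝓡 2) ψ.symm z u) :=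
      mfderiv_comp_apply z ((hF _).mdifferentiableAt (by simp))
        ((contMDiffAt_extChartAt_symm h4).mdifferentiableAt (by simp)) u
    exact e1.symm.trans ((mfderiv_apply_congr h1 u).trans e2)
  -- Both exterior derivatives are the area form in charts, at the image point for `s'`. Their
  -- agreement through the derivative of `G` is precisely `F^* ω = ω`.
  obtain ⟨k, hk⟩ := exists_hasFDerivAt_sub_pullback hA hA' hG1 (by
    filter_upwards [hsz, hsz', hmGF, hGF, hGt, hz₀t] with z h1 h2 h3 h4 h5 h6 u v
    have e0 : ψ'.symm (G z) = (F ∘ ψ.symm) z := h4.self_of_nhds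
    have e1 := P.extDer_pullForm_section (c := ψ'.symm) (e := G z) (s := s')
      (by rw [e0]; exact h2.1) (by rw [e0]; exact h2.2)
      ((contMDiffAt_extChartAt_symm h5).of_le (by norm_cast)) (fderiv ℝ G z u) (fderiv ℝ G z v)
    have e2 := P.extDer_pullForm_section (c := ψ.symm) (e := z) (s := s) h1.1 h1.2
      ((contMDiffAt_extChartAt_symm h6).of_le (by norm_cast)) u v
    have e3 := P.area.apply_congr e0 (h3 u) (h3 v)
    exact e1.trans (e3.trans ((hFa _ _ _).trans e2.symm)))
  have hpull : ∀ᶠ z in 𝓝 z₀, (pullForm P.η (s' ∘ ψ'.symm) (G z)).comp (fderiv ℝ G z) =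
      pullForm P.η ((s' ∘ F) ∘ ψ.symm) z := by
    filter_upwards [hGF, hGc, hGt, hsz'] with z h1 h2 h3 h4
    have e0 : ψ'.symm (G z) = (F ∘ ψ.symm) z := h1.self_of_nhds
    rw [← pullForm_comp]
    · refine pullForm_congr _ ?_
      filter_upwards [h1] with y hy
      exact congrArg s' hy
    · refine MDifferentiableAt.comp (G z) ?_
        ((contMDiffAt_extChartAt_symm h3).mdifferentiableAt (by simp))
      rw [e0]
      exact h4.1.mdifferentiableAt (by simp)
    · exact h2.contDiffAt.differentiableAt (by simp)
  have hs'F : ∀ᶠ q in 𝓝 q₀, ContMDiffAt (𝓡 2) (𝓡 3) 1 (s' ∘ F) q := by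
    filter_upwards [hF.continuous.continuousAt.eventually hsev'] with q hq
    exact ContMDiffAt.comp q (hq.1.of_le (by norm_cast)) (hF q)
  have hkd : ∀ᶠ z in 𝓝 z₀, HasFDerivAt k (pullForm P.η (s ∘ ψ.symm) z -
      pullForm P.η ((s' ∘ F) ∘ ψ.symm) z) z := by
    filter_upwards [hk, hpull] with z h1 h2
    rwa [h2] at h1
  -- The derivative of `k` is continuous near `z₀`, which makes `k` of class `C¹` there.
  have hkc : ∀ᶠ z in 𝓝 z₀, ContinuousAt (fun z ↦ pullForm P.η (s ∘ ψ.symm) z -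
      pullForm P.η ((s' ∘ F) ∘ ψ.symm) z) z := by
    filter_upwards [hA.eventually (by simp), hψc.eventually (by rw [hψq]; exact hs'F), hz₀t]
      with z h1 h2 h3
    have h4 : ContDiffAt ℝ ((0 : ℕ∞) : WithTop ℕ∞) (pullForm P.η ((s' ∘ F) ∘ ψ.symm)) z :=
      contDiffAt_pullForm (m := 0) (k := 1) P.isSmooth_η (ContMDiffAt.comp z h2
        ((contMDiffAt_extChartAt_symm h3).of_le (by norm_cast))) (by norm_cast)
    exact h1.continuousAt.sub h4.continuousAt
  have hk1 : ∀ᶠ z in 𝓝 z₀, ContDiffAt ℝ 1 k z := by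
    filter_upwards [(hkd.and hkc).eventually_nhds] with z hz
    obtain ⟨u, hu, huo, hzu⟩ := mem_nhds_iff.1 hz
    exact contDiffAt_one_iff.2 ⟨_, u, huo.mem_nhds hzu,
      fun y hy ↦ (hu hy).2.continuousWithinAt, fun y hy ↦ (hu hy).1⟩
  have hψ0 : ContinuousAt ψ q₀ := continuousAt_extChartAt (I := 𝓡 2) q₀
  refine ⟨k ∘ ψ, ?_⟩
  filter_upwards [hψ0.eventually hkd, hψ0.eventually hk1, hsev, hs'F,
    extChartAt_source_mem_nhds (I := 𝓡 2) q₀] with q h1 h2 h3 h4 h5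
  have hψq' : ContMDiffAt (𝓡 2) (𝓡 2) 1 ψ q := contMDiffAt_extChartAt' (by simpa using h5)
  refine ⟨h2.contMDiffAt.comp q hψq', fun w ↦ ?_⟩
  have e1 : mfderiv (𝓡 2) 𝓘(ℝ, ℝ) (k ∘ ψ) q w =
      mfderiv (𝓡 2) 𝓘(ℝ, ℝ) k (ψ q) (mfderiv (𝓡 2) (𝓡 2) ψ q w) :=
    mfderiv_comp_apply q (h2.contMDiffAt.mdifferentiableAt (by simp))
      (hψq'.mdifferentiableAt (by simp)) w
  rw [mfderiv_eq_fderiv, h1.fderiv] at e1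
  refine e1.trans (congrArg₂ (fun a b : ℝ ↦ a - b) ?_ ?_)
  · exact pullForm_comp_extChartAt_symm P.η h5 (h3.1.mdifferentiableAt (by simp)) w
  · exact pullForm_comp_extChartAt_symm P.η h5 (h4.mdifferentiableAt (by simp)) w

end ContactCircleBundle

open Filter Topology

/-- Functions with equal differentials which agree at a point agree near it. -/
theorem eventuallyEq_of_mfderiv_eq {n : ℕ} {X : Type*} [TopologicalSpace X]
    [ChartedSpace (EuclideanSpace ℝ (Fin n)) X] [IsManifold (𝓡 n) ∞ X] {a b : X → ℝ} {q₀ : X}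
    (h : ∀ᶠ q in 𝓝 q₀, MDifferentiableAt (𝓡 n) 𝓘(ℝ, ℝ) a q ∧ MDifferentiableAt (𝓡 n) 𝓘(ℝ, ℝ) b q ∧
      ∀ w : TangentSpace (𝓡 n) q, (mfderiv (𝓡 n) 𝓘(ℝ, ℝ) a q w : ℝ) = mfderiv (𝓡 n) 𝓘(ℝ, ℝ) b q w)
    (h₀ : a q₀ = b q₀) : a =ᶠ[𝓝 q₀] b := by
  set ψ := extChartAt (𝓡 n) q₀ with hψ
  have hz₀ : ψ q₀ ∈ ψ.target := ψ.map_source (mem_extChartAt_source q₀)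
  have hψq : ψ.symm (ψ q₀) = q₀ := ψ.left_inv (mem_extChartAt_source q₀)
  have hc : ContinuousAt ψ.symm (ψ q₀) := (contMDiffAt_extChartAt_symm hz₀).continuousAt
  have h1 : ∀ᶠ z in 𝓝 (ψ q₀), z ∈ ψ.target :=
    (isOpen_extChartAt_target (I := 𝓡 n) q₀).mem_nhds hz₀
  obtain ⟨r, hr, hball⟩ := Metric.eventually_nhds_iff_ball.1
    ((hc.eventually (by rwa [hψq])).and h1)
  have hd : ∀ z ∈ Metric.ball (ψ q₀) r, MDifferentiableAt (𝓡 n) (𝓡 n) ψ.symm z := fun z hz ↦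
    (contMDiffAt_extChartAt_symm (hball z hz).2).mdifferentiableAt (by simp)
  have key : EqOn (a ∘ ψ.symm) (b ∘ ψ.symm) (Metric.ball (ψ q₀) r) := by
    refine Metric.isOpen_ball.eqOn_of_fderiv_eq (𝕜 := ℝ)
      (convex_ball (ψ q₀) r).isPreconnected ?_ ?_ ?_ (Metric.mem_ball_self hr) ?_
    · exact fun z hz ↦ ((hball z hz).1.1.comp z (hd z hz)).differentiableAt.differentiableWithinAt
    · exact fun z hz ↦ ((hball z hz).1.2.1.comp z (hd z hz)).differentiableAt.differentiableWithinAt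
    · intro z hz
      ext1 w
      have e1 : (mfderiv (𝓡 n) 𝓘(ℝ, ℝ) (a ∘ ψ.symm) z w : ℝ) =
        mfderiv (𝓡 n) 𝓘(ℝ, ℝ) a (ψ.symm z) (mfderiv (𝓡 n) (𝓡 n) ψ.symm z w) :=
        mfderiv_comp_apply z (hball z hz).1.1 (hd z hz) w
      have e2 : (mfderiv (𝓡 n) 𝓘(ℝ, ℝ) (b ∘ ψ.symm) z w : ℝ) =
        mfderiv (𝓡 n) 𝓘(ℝ, ℝ) b (ψ.symm z) (mfderiv (𝓡 n) (𝓡 n) ψ.symm z w) :=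
        mfderiv_comp_apply z (hball z hz).1.2.1 (hd z hz) w
      rw [mfderiv_eq_fderiv] at e1 e2
      exact e1.trans (((hball z hz).1.2.2 _).trans e2.symm)
    · simp only [Function.comp_apply, hψq, h₀]
  filter_upwards [(continuousAt_extChartAt (I := 𝓡 n) q₀).eventually (Metric.ball_mem_nhds _ hr),
    extChartAt_source_mem_nhds (I := 𝓡 n) q₀] with q hq hqs
  have := key hq
  simp only [Function.comp_apply] at this
  rwa [ψ.left_inv hqs] at this

/-! ### Lifts of `F` preserving `η`: local existence and local uniqueness up to rotation. -/

namespace ContactCircleBundle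

variable {M : Type*} [TopologicalSpace M] [ChartedSpace (EuclideanSpace ℝ (Fin 3)) M]
  [IsManifold (𝓡 3) ∞ M] {S : Type*} [TopologicalSpace S]
  [ChartedSpace (EuclideanSpace ℝ (Fin 2)) S] [IsManifold (𝓡 2) ∞ S]
  (P : ContactCircleBundle M S)

/-- Over `W` the map `f` is an equivariant lift of `F` which preserves the contact form. -/
structure IsLiftOn (F : S → S) (W : Set S) (f : M → M) : Prop where
  contMDiffAt : ∀ x, P.p x ∈ W → ContMDiffAt (𝓡 3) (𝓡 3) 1 f x
  map_U : ∀ θ x, P.p x ∈ W → f (P.U θ x) = P.U θ (f x)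
  p_map : ∀ x, P.p x ∈ W → P.p (f x) = F (P.p x)
  η_mfderiv : ∀ x, P.p x ∈ W → ∀ v : TangentSpace (𝓡 3) x,
    P.η (f x) (mfderiv (𝓡 3) (𝓡 3) f x v) = P.η x v

variable {P} {F : S → S} {W W' : Set S} {f g : M → M}

theorem IsLiftOn.mono (h : P.IsLiftOn F W f) (hW : W' ⊆ W) : P.IsLiftOn F W' f where
  contMDiffAt x hx := h.contMDiffAt x (hW hx)
  map_U θ x hx := h.map_U θ x (hW hx)
  p_map x hx := h.p_map x (hW hx)
  η_mfderiv x hx := h.η_mfderiv x (hW hx)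

theorem IsLiftOn.rotate (h : P.IsLiftOn F W f) (θ : Real.Angle) :
    P.IsLiftOn F W (fun x ↦ P.U θ (f x)) where
  contMDiffAt x hx := ContMDiffAt.comp x ((P.contMDiff_U θ _).of_le (by norm_cast))
    (h.contMDiffAt x hx)
  map_U φ x hx := by rw [h.map_U φ x hx, P.U_comm]
  p_map x hx := by rw [P.p_U, h.p_map x hx]
  η_mfderiv x hx v := by
    have e : mfderiv (𝓡 3) (𝓡 3) (P.U θ ∘ f) x v =
        mfderiv (𝓡 3) (𝓡 3) (P.U θ) (f x) (mfderiv (𝓡 3) (𝓡 3) f x v) :=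
      mfderiv_comp_apply x ((P.contMDiff_U θ _).mdifferentiableAt (by simp))
        ((h.contMDiffAt x hx).mdifferentiableAt (by simp)) v
    exact (P.η.apply_congr rfl e).trans ((P.η_mfderiv_U θ _ _).trans (h.η_mfderiv x hx v))

theorem IsLiftOn.congr (h : P.IsLiftOn F W f) (hW : IsOpen W)
    (hfg : ∀ x, P.p x ∈ W → g x = f x) : P.IsLiftOn F W g where
  contMDiffAt x hx := (h.contMDiffAt x hx).congr_of_eventuallyEq <| by
    filter_upwards [P.p_smooth.continuous.continuousAt.eventually (hW.mem_nhds hx)] with y hy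
      using hfg y hy
  map_U θ x hx := by
    rw [hfg x hx, hfg _ (by rwa [P.p_U]), h.map_U θ x hx]
  p_map x hx := by rw [hfg x hx, h.p_map x hx]
  η_mfderiv x hx v := by
    have e : g =ᶠ[𝓝 x] f := by
      filter_upwards [P.p_smooth.continuous.continuousAt.eventually (hW.mem_nhds hx)] with y hy
        using hfg y hy
    exact (P.η.apply_congr (hfg x hx) (mfderiv_apply_congr e v)).trans (h.η_mfderiv x hx v)

/-- Being a lift is a local property. -/
theorem isLiftOn_of_forall_mem (h : ∀ q ∈ W, ∃ W', q ∈ W' ∧ P.IsLiftOn F W' f) :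
    P.IsLiftOn F W f where
  contMDiffAt x hx := by
    obtain ⟨W', hq, hW'⟩ := h _ hx
    exact hW'.contMDiffAt x hq
  map_U θ x hx := by
    obtain ⟨W', hq, hW'⟩ := h _ hx
    exact hW'.map_U θ x hq
  p_map x hx := by
    obtain ⟨W', hq, hW'⟩ := h _ hx
    exact hW'.p_map x hq
  η_mfderiv x hx := by
    obtain ⟨W', hq, hW'⟩ := h _ hx
    exact hW'.η_mfderiv x hq

variable (P)

/-- The contact form on rotated maps that factor through the projection. -/
theorem η_mfderiv_U_comp_p {τ : M → ℝ} {k : S → M} {f : M → M} {x : M}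
    (hτ : MDifferentiableAt (𝓡 3) 𝓘(ℝ, ℝ) τ x) (hk : MDifferentiableAt (𝓡 2) (𝓡 3) k (P.p x))
    (hf : f =ᶠ[𝓝 x] fun y ↦ P.U (τ y) (k (P.p y))) (v : TangentSpace (𝓡 3) x) :
    P.η (f x) (mfderiv (𝓡 3) (𝓡 3) f x v) = (show ℝ from mfderiv (𝓡 3) 𝓘(ℝ, ℝ) τ x v) +
      P.η (k (P.p x)) (mfderiv (𝓡 2) (𝓡 3) k (P.p x) (mfderiv (𝓡 3) (𝓡 2) P.p x v)) := by
  have hp : MDifferentiableAt (𝓡 3) (𝓡 2) P.p x := (P.p_smooth x).mdifferentiableAt (by simp)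
  have e1 := P.η_mfderiv_U_comp (m := k ∘ P.p) hτ (hk.comp x hp) v
  have e2 : mfderiv (𝓡 3) (𝓡 3) (k ∘ P.p) x v =
      mfderiv (𝓡 2) (𝓡 3) k (P.p x) (mfderiv (𝓡 3) (𝓡 2) P.p x v) := mfderiv_comp_apply x hk hp v
  refine (P.η.apply_congr hf.self_of_nhds (mfderiv_apply_congr hf v)).trans (e1.trans ?_)
  exact congrArg _ (P.η.apply_congr rfl e2)

/-- Local existence of lifts. -/
theorem exists_isLiftOn (hF : ContMDiff (𝓡 2) (𝓡 2) 1 F) (hFa : PreservesArea P.area F) (q₀ : S) :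
    ∃ W, IsOpen W ∧ q₀ ∈ W ∧ ∃ f, P.IsLiftOn F W f := by
  obtain ⟨x₀, rfl⟩ := P.p_surjective q₀
  obtain ⟨y₀, hy₀⟩ := P.p_surjective (F (P.p x₀))
  obtain ⟨W₁, hW₁, hx₀, s, -, hs, hτ⟩ := P.exists_local_section x₀
  obtain ⟨W₂, hW₂, hyW, s', -, hs', -⟩ := P.exists_local_section y₀
  rw [hy₀] at hyW
  obtain ⟨h, hh⟩ := P.exists_primitive hF hFa (hs _ hx₀).1
    ((hW₁.eventually_mem hx₀).mono fun q hq ↦ (hs q hq).2) (hs' _ hyW).1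
    ((hW₂.eventually_mem hyW).mono fun q hq ↦ (hs' q hq).2)
  obtain ⟨W, hW, hWo, hxW⟩ := mem_nhds_iff.1 ((hh.and (hW₁.mem_nhds hx₀)).and
    (hF.continuous.continuousAt.eventually (hW₂.mem_nhds hyW)))
  -- The image of the section `s` under the lift. The choice of `h` makes the pullbacks of `η` by
  -- `k` and by `s` equal.
  let k : S → M := fun q ↦ P.U (h q) (s' (F q))
  have hs'F : ∀ q ∈ W, ContMDiffAt (𝓡 2) (𝓡 3) 1 (s' ∘ F) q := fun q hq ↦
    ContMDiffAt.comp q ((hs' _ (hW hq).2).1.of_le (by norm_cast)) (hF q)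
  have hk : ∀ q ∈ W, ContMDiffAt (𝓡 2) (𝓡 3) 1 k q := fun q hq ↦
    P.contMDiffAt_U_comp (k := 1) (hW hq).1.1.1 (hs'F q hq)
  have hang : ∀ x : M, ∃ θ : Real.Angle, P.p x ∈ W → P.U θ (s (P.p x)) = x := by
    intro x
    by_cases hx : P.p x ∈ W
    · obtain ⟨θ, hθ⟩ := (P.p_eq_iff (s (P.p x)) x).1 (hs _ (hW hx).1.2).2
      exact ⟨θ, fun _ ↦ hθ⟩
    · exact ⟨0, fun hx' ↦ absurd hx' hx⟩
  choose ang hang using hang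
  let f : M → M := fun x ↦ P.U (ang x) (k (P.p x))
  -- The angles `ang` are chosen pointwise, without any regularity. Freeness of the action makes
  -- them unique, so `f` also has local expressions in terms of the regular angle functions `τ`.
  have hf : ∀ x, P.p x ∈ W → ∀ θ, P.U θ (s (P.p x)) = x → f x = P.U θ (k (P.p x)) := by
    intro x hx θ hθ
    simp only [f]
    rw [P.U_inj ((hang x hx).trans hθ.symm)]
  have hloc : ∀ x, P.p x ∈ W → ∃ τ : M → ℝ, ContMDiffAt (𝓡 3) 𝓘(ℝ, ℝ) 2 τ x ∧
      (id =ᶠ[𝓝 x] fun y ↦ P.U (τ y) (s (P.p y))) ∧ f =ᶠ[𝓝 x] fun y ↦ P.U (τ y) (k (P.p y)) := by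
    intro x hx
    obtain ⟨τ, h1, h2⟩ := hτ x (hW hx).1.2
    refine ⟨τ, h1, h2.mono fun y hy ↦ hy.symm, ?_⟩
    filter_upwards [h2, P.p_smooth.continuous.continuousAt.eventually (hWo.mem_nhds hx)] with y h3 h4
    exact hf y h4 _ h3
  refine ⟨W, hWo, hxW, f, ?_, ?_, ?_, ?_⟩
  · intro x hx
    obtain ⟨τ, h1, -, h3⟩ := hloc x hx
    refine ContMDiffAt.congr_of_eventuallyEq ?_ h3
    exact P.contMDiffAt_U_comp (k := 1) (h1.of_le (by norm_cast))
      ((hk _ hx).comp x ((P.p_smooth x).of_le (by norm_cast)))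
  · intro θ x hx
    have h1 := hf (P.U θ x) (by rwa [P.p_U]) (θ + ang x) (by rw [P.p_U, P.U_add, hang x hx])
    rw [h1, P.p_U, P.U_add]
  · intro x hx
    simp only [f, k, P.p_U]
    exact (hs' _ (hW hx).2).2
  · intro x hx v
    obtain ⟨τ, h1, h2, h3⟩ := hloc x hx
    -- `f^* η` is `dτ` plus the pullback of `k^* η`, and `η` itself, written through the identity
    -- map, is `dτ` plus the pullback of `s^* η`. The angular parts agree, and so do the others by
    -- the choice of `h`.
    have e1 := P.η_mfderiv_U_comp_p (h1.mdifferentiableAt (by simp))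
      ((hk _ hx).mdifferentiableAt (by simp)) h3 v
    have e2 := P.η_mfderiv_U_comp_p (h1.mdifferentiableAt (by simp))
      ((hs _ (hW hx).1.2).1.mdifferentiableAt (by simp)) h2 v
    rw [mfderiv_id] at e2
    have e3 := P.η_mfderiv_U_comp ((hW hx).1.1.1.mdifferentiableAt (by simp))
      ((hs'F _ hx).mdifferentiableAt (by simp)) (mfderiv (𝓡 3) (𝓡 2) P.p x v)
    have e4 := (hW hx).1.1.2 (mfderiv (𝓡 3) (𝓡 2) P.p x v)
    refine e1.trans (Eq.trans ?_ e2.symm)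
    refine congrArg _ (e3.trans ?_)
    refine (congrArg (fun a : ℝ ↦ a + _) e4).trans ?_
    exact sub_add_cancel _ _

/-- Lifts are locally unique up to rotation. -/
theorem IsLiftOn.exists_rotation {P : ContactCircleBundle M S} {f₁ f₂ : M → M}
    (hF : ContMDiff (𝓡 2) (𝓡 2) 1 F) (hW : IsOpen W) (h₁ : P.IsLiftOn F W f₁)
    (h₂ : P.IsLiftOn F W f₂) {q₀ : S} (hq₀ : q₀ ∈ W) :
    ∃ θ, ∀ᶠ q in 𝓝 q₀, ∀ x, P.p x = q → f₂ x = P.U θ (f₁ x) := by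
  obtain ⟨x₀, rfl⟩ := P.p_surjective q₀
  obtain ⟨θ, hθ⟩ := (P.p_eq_iff (f₁ x₀) (f₂ x₀)).1 (by rw [h₁.p_map _ hq₀, h₂.p_map _ hq₀])
  refine ⟨θ, ?_⟩
  obtain ⟨W₁, hW₁, hx₀, s, hsx, hs, -⟩ := P.exists_local_section x₀
  obtain ⟨W₂, hW₂, hy₀, s', -, hs', hτ⟩ := P.exists_local_section (f₂ x₀)
  obtain ⟨τ, hτ, hτU⟩ := hτ _ hy₀
  have : IsManifold (𝓡 3) 2 M := .of_le (n := ∞) (by norm_cast)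
  have hτ' := (contMDiffAt_iff_contMDiffAt_nhds (by norm_cast)).1 hτ
  have hFq : ∀ᶠ q in 𝓝 (P.p x₀), F q ∈ W₂ := hF.continuous.continuousAt.eventually
    (hW₂.mem_nhds (by rwa [← h₂.p_map _ hq₀]))
  -- a lift in the local trivialization
  have key : ∀ f, P.IsLiftOn F W f → f x₀ = f₂ x₀ → ∀ᶠ q in 𝓝 (P.p x₀),
      MDifferentiableAt (𝓡 2) 𝓘(ℝ, ℝ) (τ ∘ (f ∘ s)) q ∧
      (∀ w : TangentSpace (𝓡 2) q, (mfderiv (𝓡 2) 𝓘(ℝ, ℝ) (τ ∘ (f ∘ s)) q w : ℝ) =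
        P.η (s q) (mfderiv (𝓡 2) (𝓡 3) s q w) -
          P.η (s' (F q)) (mfderiv (𝓡 2) (𝓡 3) (s' ∘ F) q w)) ∧
      f (s q) = P.U (τ (f (s q))) (s' (F q)) := by
    intro f hf hfx
    have hfs : ∀ q ∈ W ∩ W₁, ContMDiffAt (𝓡 2) (𝓡 3) 1 (f ∘ s) q := fun q hq ↦
      ContMDiffAt.comp q (hf.contMDiffAt _ (by rw [(hs q hq.2).2]; exact hq.1))
        ((hs q hq.2).1.of_le (by norm_cast))
    have hfsx : (f ∘ s) (P.p x₀) = f₂ x₀ := by rw [Function.comp_apply, hsx, hfx]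
    have hWW : ∀ᶠ q in 𝓝 (P.p x₀), q ∈ W ∩ W₁ := (hW.inter hW₁).mem_nhds ⟨hq₀, hx₀⟩
    have h3 := (hfs _ ⟨hq₀, hx₀⟩).continuousAt.eventually (by rw [hfsx]; exact hτ'.and hτU)
    have hrep : ∀ᶠ q in 𝓝 (P.p x₀), (f ∘ s) q = P.U (τ ((f ∘ s) q)) ((s' ∘ F) q) := by
      filter_upwards [h3, hWW] with q h4 h5
      have h6 := h4.2
      rw [Function.comp_apply, hf.p_map _ (by rw [(hs q h5.2).2]; exact h5.1), (hs q h5.2).2] at h6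
      exact h6.symm
    filter_upwards [h3, hWW, hrep.eventually_nhds, hFq] with q h4 h5 h6 h7
    have hd : MDifferentiableAt (𝓡 2) 𝓘(ℝ, ℝ) (τ ∘ (f ∘ s)) q :=
      (h4.1.mdifferentiableAt (by simp)).comp q ((hfs q h5).mdifferentiableAt (by simp))
    have hs'F : ContMDiffAt (𝓡 2) (𝓡 3) 1 (s' ∘ F) q :=
      ContMDiffAt.comp q ((hs' _ h7).1.of_le (by norm_cast)) (hF q)
    refine ⟨hd, fun w ↦ ?_, h6.self_of_nhds⟩
    have hpsW : P.p (s q) ∈ W := by rw [(hs q h5.2).2]; exact h5.1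
    have e1 := P.η_mfderiv_U_comp hd (hs'F.mdifferentiableAt (by simp)) w
    have e2 : mfderiv (𝓡 2) (𝓡 3) (f ∘ s) q w =
        mfderiv (𝓡 3) (𝓡 3) f (s q) (mfderiv (𝓡 2) (𝓡 3) s q w) :=
      mfderiv_comp_apply q ((hf.contMDiffAt _ hpsW).mdifferentiableAt (by simp))
        ((hs q h5.2).1.mdifferentiableAt (by simp)) w
    have e3 := P.η.apply_congr h6.self_of_nhds (mfderiv_apply_congr h6 w)
    have e4 := hf.η_mfderiv _ hpsW (mfderiv (𝓡 2) (𝓡 3) s q w)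
    exact eq_sub_of_add_eq
      (e1.symm.trans (e3.symm.trans ((P.η.apply_congr rfl e2).trans e4)))
  have k₁ := key _ (h₁.rotate θ) hθ
  have k₂ := key _ h₂ rfl
  -- After rotation by `θ` both lifts send `x₀` to `f₂ x₀`. Their angles along `s` are primitives of
  -- the same form with the same value at `p x₀`, hence agree nearby; equivariance extends this from
  -- `s` to whole fibres.
  have hτeq := eventuallyEq_of_mfderiv_eq (a := τ ∘ (f₂ ∘ s))
    (b := τ ∘ ((fun x ↦ P.U θ (f₁ x)) ∘ s)) (q₀ := P.p x₀) (by
    filter_upwards [k₁, k₂] with q h3 h4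
    exact ⟨h4.1, h3.1, fun w ↦ (h4.2.1 w).trans (h3.2.1 w).symm⟩)
    (by simp only [Function.comp_apply, hsx, hθ])
  filter_upwards [k₁, k₂, hτeq, (hW.inter hW₁).mem_nhds ⟨hq₀, hx₀⟩] with q h3 h4 h5 h6 x hx
  have h7 : f₂ (s q) = P.U θ (f₁ (s q)) := by
    refine h4.2.2.trans (Eq.trans ?_ h3.2.2.symm)
    exact congrArg (fun t : ℝ ↦ P.U t (s' (F q))) h5
  have hpsW : P.p (s q) ∈ W := by rw [(hs q h6.2).2]; exact h6.1
  obtain ⟨φ, rfl⟩ := (P.p_eq_iff (s q) x).1 (by rw [(hs q h6.2).2, hx])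
  rw [h₂.map_U _ _ hpsW, h₁.map_U _ _ hpsW, h7, P.U_comm]

end ContactCircleBundle

/-! ### From local to global lifts. -/

/-- A locally constant cocycle becomes a coboundary on a simply connected space. -/
theorem exists_locally_const_coboundary {ι X A G : Type*} [TopologicalSpace X] [TopologicalSpace A]
    [SimplyConnectedSpace A] [LocallyPathConnectedSpace A] [AddCommGroup G] (W : ι → Set X)
    (hW : ∀ i, IsOpen (W i)) (index : X → ι) (hindex : ∀ q, q ∈ W (index q)) (g : ι → ι → X → G)
    (hg : ∀ i j, ∀ q ∈ W i ∩ W j, ∀ᶠ q' in 𝓝 q, g i j q' = g i j q)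
    (hcomp : ∀ i j k, ∀ q ∈ W i ∩ W j ∩ W k, g j k q + g i j q = g i k q) {c : A → X}
    (hc : Continuous c) :
    ∃ t : ι → A → G, (∀ i a, c a ∈ W i → ∀ᶠ a' in 𝓝 a, t i a' = t i a) ∧
      ∀ i j a, c a ∈ W i ∩ W j → t j a = g i j (c a) + t i a := by
  -- With the discrete topology on `G`, locally constant transition functions are continuous and
  -- glue a covering space of `X`. Simple connectedness of `A` lifts `c` to it, and the fibre
  -- coordinates of the lift are the functions `t i`.
  let : TopologicalSpace G := ⊥
  have : DiscreteTopology G := ⟨rfl⟩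
  let Z : FiberBundleCore ι X G :=
    { baseSet := W
      isOpen_baseSet := hW
      indexAt := index
      mem_baseSet_at := hindex
      coordChange := fun i j q v ↦ g i j q + v
      coordChange_self := fun i q hq v ↦ by
        have := hcomp i i i q ⟨⟨hq, hq⟩, hq⟩
        rw [add_eq_right] at this
        simp [this]
      continuousOn_coordChange := fun i j z hz ↦ by
        refine ContinuousAt.continuousWithinAt ?_
        have h1 : ContinuousAt (fun z : X × G ↦ g i j z.1) z :=
          ContinuousAt.congr continuousAt_const
            (((continuous_fst.continuousAt (x := z)).eventually (hg i j z.1 hz.1)).mono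
              fun y hy ↦ hy.symm)
        exact h1.add continuous_snd.continuousAt
      coordChange_comp := fun i j k q hq v ↦ by rw [← add_assoc, hcomp i j k q hq] }
  have hcov : IsCoveringMap (π G Z.Fiber) := FiberBundle.isCoveringMap
  obtain ⟨a₀⟩ : Nonempty A := inferInstance
  obtain ⟨σ, ⟨-, hσ⟩, -⟩ := hcov.existsUnique_continuousMap_lifts ⟨c, hc⟩ a₀
    (⟨c a₀, (0 : G)⟩ : Z.TotalSpace) rfl
  have hσc : ∀ a, (σ a).1 = c a := fun a ↦ congrFun hσ a
  refine ⟨fun i a ↦ (Z.localTriv i (σ a)).2, fun i a ha ↦ ?_, fun i j a ha ↦ ?_⟩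
  · have h1 : ContinuousAt (fun a ↦ (Z.localTriv i (σ a)).2) a := by
      refine continuous_snd.continuousAt.comp ?_
      refine ContinuousAt.comp (g := Z.localTriv i) ?_ σ.continuous.continuousAt
      refine (Z.localTriv i).continuousAt ?_
      rw [FiberBundleCore.mem_localTriv_source]
      exact (hσc a).symm ▸ ha
    exact h1.eventually (show ({(Z.localTriv i (σ a)).2} : Set G) ∈ 𝓝 _ by simp)
  · have h1 := hcomp (index (σ a).1) i j (σ a).1 ⟨⟨hindex _, (hσc a).symm ▸ ha.1⟩,
      (hσc a).symm ▸ ha.2⟩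
    let v : G := (σ a).2
    change g (index (σ a).1) j (σ a).1 + v = g i j (c a) + (g (index (σ a).1) i (σ a).1 + v)
    rw [← h1, ← hσc a, add_assoc]

namespace ContactCircleBundle

variable {M : Type*} [TopologicalSpace M] [ChartedSpace (EuclideanSpace ℝ (Fin 3)) M]
  [IsManifold (𝓡 3) ∞ M] {S : Type*} [TopologicalSpace S]
  [ChartedSpace (EuclideanSpace ℝ (Fin 2)) S] [IsManifold (𝓡 2) ∞ S]
  {P : ContactCircleBundle M S} {F : S → S}

/-- Existence of lifts over open discs. -/
theorem exists_isLiftOn_source (hF : ContMDiff (𝓡 2) (𝓡 2) 1 F) (hFa : PreservesArea P.area F)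
    {V : Type*} [NormedAddCommGroup V] [NormedSpace ℝ V] (e : OpenPartialHomeomorph S V)
    (he : e.target = univ) : ∃ f, P.IsLiftOn F e.source f := by
  -- The cover is indexed by all local lifts. The rotations comparing them form a cocycle, locally
  -- constant by `IsLiftOn.exists_rotation`.
  let ι := {w : Set S × (M → M) // IsOpen w.1 ∧ P.IsLiftOn F w.1 w.2}
  have hrot : ∀ i j : ι, ∀ q ∈ i.1.1 ∩ j.1.1, ∃ θ, ∀ᶠ q' in 𝓝 q, ∀ x, P.p x = q' →
      i.1.2 x = P.U θ (j.1.2 x) := fun i j q hq ↦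
    IsLiftOn.exists_rotation hF (i.2.1.inter j.2.1) (j.2.2.mono inter_subset_right)
      (i.2.2.mono inter_subset_left) hq
  have hg : ∀ i j : ι, ∀ q, ∃ θ, q ∈ i.1.1 ∩ j.1.1 → ∀ x, P.p x = q →
      i.1.2 x = P.U θ (j.1.2 x) := by
    intro i j q
    by_cases hq : q ∈ i.1.1 ∩ j.1.1
    · obtain ⟨θ, hθ⟩ := hrot i j q hq
      exact ⟨θ, fun _ ↦ hθ.self_of_nhds⟩
    · exact ⟨0, fun h ↦ absurd h hq⟩
  choose g hg using hg
  have hindex : ∀ q, ∃ i : ι, q ∈ i.1.1 := by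
    intro q
    obtain ⟨W, hW, hq, f, hf⟩ := P.exists_isLiftOn hF hFa q
    exact ⟨⟨(W, f), hW, hf⟩, hq⟩
  choose index hindex using hindex
  have hgc : ∀ i j : ι, ∀ q ∈ i.1.1 ∩ j.1.1, ∀ᶠ q' in 𝓝 q, g i j q' = g i j q := by
    intro i j q hq
    obtain ⟨θ, hθ⟩ := hrot i j q hq
    have h1 : ∀ᶠ q' in 𝓝 q, g i j q' = θ := by
      filter_upwards [hθ, (i.2.1.inter j.2.1).mem_nhds hq] with q' h2 h3
      obtain ⟨x, hx⟩ := P.p_surjective q'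
      exact P.U_inj ((hg i j q' h3 x hx).symm.trans (h2 x hx))
    filter_upwards [h1] with q' h2
    rw [h2, h1.self_of_nhds]
  obtain ⟨t, ht, htg⟩ := exists_locally_const_coboundary (fun i : ι ↦ i.1.1) (fun i ↦ i.2.1)
    index hindex g hgc (by
      rintro i j k q ⟨⟨hi, hj⟩, hk⟩
      obtain ⟨x, hx⟩ := P.p_surjective q
      refine P.U_inj (x := k.1.2 x) ?_
      rw [← hg i k q ⟨hi, hk⟩ x hx, add_comm, P.U_add, ← hg j k q ⟨hj, hk⟩ x hx,
        ← hg i j q ⟨hi, hj⟩ x hx])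
    -- Since the target of `e` is everything, `e.symm` is a continuous map on all of `V`, which is
    -- simply connected.
    (continuousOn_univ.1 (he ▸ e.continuousOn_symm))
  -- Rotating the `i`-th lift by `t i` gives the same value for every `i`, by the coboundary
  -- relation. The choice of index is thus immaterial, and `f` is locally a constant rotation of a
  -- single lift.
  let f : M → M := fun x ↦ P.U (t (index (P.p x)) (e (P.p x))) ((index (P.p x)).1.2 x)
  refine ⟨f, isLiftOn_of_forall_mem fun q hq ↦ ?_⟩
  have hf : ∀ i : ι, ∀ x, P.p x ∈ e.source → P.p x ∈ i.1.1 →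
      f x = P.U (t i (e (P.p x))) (i.1.2 x) := by
    intro i x hxe hxi
    have h1 := htg i (index (P.p x)) (e (P.p x)) (by
      rw [e.left_inv hxe]
      exact ⟨hxi, hindex _⟩)
    rw [e.left_inv hxe, add_comm] at h1
    simp only [f]
    rw [h1, P.U_add, ← hg _ _ _ ⟨hxi, hindex _⟩ x rfl]
  have h1 := (e.continuousAt hq).eventually
    (ht (index q) (e q) (by rw [e.left_inv hq]; exact hindex q))
  obtain ⟨W, hW, hWo, hqW⟩ := mem_nhds_iff.1
    ((h1.and (e.open_source.mem_nhds hq)).and ((index q).2.1.mem_nhds (hindex q)))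
  refine ⟨W, hqW, (((index q).2.2.mono fun y hy ↦ (hW hy).2).rotate (t (index q) (e q))).congr hWo
    fun x hx ↦ ?_⟩
  rw [hf (index q) x (hW hx).1.2 (hW hx).2, (hW hx).1.1]

/-- Lifts over a connected open set are unique up to rotation. -/
theorem IsLiftOn.exists_rotation_of_isPreconnected (hF : ContMDiff (𝓡 2) (𝓡 2) 1 F) {W : Set S}
    (hW : IsOpen W) (hWc : IsPreconnected W) {f₁ f₂ : M → M} (h₁ : P.IsLiftOn F W f₁)
    (h₂ : P.IsLiftOn F W f₂) : ∃ θ, ∀ x, P.p x ∈ W → f₂ x = P.U θ (f₁ x) := by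
  rcases W.eq_empty_or_nonempty with rfl | ⟨q₀, hq₀⟩
  · exact ⟨0, fun x hx ↦ hx.elim⟩
  obtain ⟨θ, hθ⟩ := h₁.exists_rotation hF hW h₂ hq₀
  refine ⟨θ, fun x hx ↦ ?_⟩
  let A : Set S := {q | ∀ᶠ q' in 𝓝 q, ∀ x, P.p x = q' → f₂ x = P.U θ (f₁ x)}
  have hA : IsOpen A := isOpen_setOfPred_eventually_nhds
  have hsub : W ⊆ A := by
    refine hWc.subset_of_closure_inter_subset hA ⟨q₀, hq₀, hθ⟩ ?_
    rintro q ⟨hqA, hqW⟩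
    obtain ⟨φ, hφ⟩ := h₁.exists_rotation hF hW h₂ hqW
    obtain ⟨O, hO, hOo, hqO⟩ := mem_nhds_iff.1 hφ
    obtain ⟨q', hq'O, hq'A⟩ := mem_closure_iff.1 hqA O hOo hqO
    obtain ⟨y, hy⟩ := P.p_surjective q'
    -- At a limit point the local rotation angle `φ` must be `θ`, because both apply at a common
    -- nearby point and the action is free. So the set where `θ` works is closed in `W`.
    have : φ = θ := P.U_inj ((hO hq'O y hy).symm.trans (Eventually.self_of_nhds hq'A y hy))
    rwa [this] at hφ
  exact Eventually.self_of_nhds (hsub hx) x rfl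

/-- Existence of lifts on the sphere. -/
theorem exists_isLiftOn_univ (hS : Nonempty (S ≃ₜ Metric.sphere (0 : EuclideanSpace ℝ (Fin 3)) 1))
    (hF : ContMDiff (𝓡 2) (𝓡 2) 1 F) (hFa : PreservesArea P.area F) :
    ∃ f, P.IsLiftOn F univ f := by
  obtain ⟨h⟩ := hS
  have : Fact (Module.finrank ℝ (EuclideanSpace ℝ (Fin 3)) = 2 + 1) := ⟨by simp⟩
  let v : Metric.sphere (0 : EuclideanSpace ℝ (Fin 3)) 1 :=
    ⟨EuclideanSpace.single 0 1, by simp⟩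
  -- Stereographic projection from `v` and from `-v` gives two discs covering `S`. These charts are
  -- only topological, which suffices for `exists_isLiftOn_source`.
  let e : Metric.sphere (0 : EuclideanSpace ℝ (Fin 3)) 1 →
      OpenPartialHomeomorph S (EuclideanSpace ℝ (Fin 2)) := fun v ↦
    h.toOpenPartialHomeomorph.trans (stereographic' 2 v)
  have hes : ∀ v, (e v).source = {h.symm v}ᶜ := fun v ↦ by
    ext q
    simp [e, Homeomorph.eq_symm_apply]
  have het : ∀ v, (e v).target = univ := fun v ↦ by simp [e]
  obtain ⟨f₁, hf₁⟩ := exists_isLiftOn_source (P := P) hF hFa (e v) (het v)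
  obtain ⟨f₂, hf₂⟩ := exists_isLiftOn_source (P := P) hF hFa (e (-v)) (het (-v))
  have hv : h.symm v ≠ h.symm (-v) := fun H ↦ by
    have h1 := congrArg (fun z : Metric.sphere (0 : EuclideanSpace ℝ (Fin 3)) 1 ↦
      (z : EuclideanSpace ℝ (Fin 3)) 0) (h.symm.injective H)
    simp [v] at h1
    norm_num at h1
  -- The overlap is a punctured plane. Its connectedness makes the two lifts differ there by one
  -- rotation `θ`, which is absorbed into `f₁`.
  have hconn : IsPreconnected ((e v).source ∩ (e (-v)).source) := by
    have h1 : (e v).source ∩ (e (-v)).source = (e v).symm '' {e v (h.symm (-v))}ᶜ := by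
      ext q
      simp only [hes]
      constructor
      · rintro ⟨hq, hq'⟩
        rw [← hes] at hq
        refine ⟨e v q, fun H ↦ hq' ((e v).injOn hq ?_ H), (e v).left_inv hq⟩
        rw [hes]
        exact hv.symm
      · rintro ⟨z, hz, rfl⟩
        have hzs : (e v).symm z ∈ (e v).source := (e v).map_target (by simp [het])
        refine ⟨(hes v).subset hzs, fun H ↦ hz ?_⟩
        rw [mem_singleton_iff, ← mem_singleton_iff.1 H, (e v).right_inv (by simp [het])]
    rw [h1]
    refine IsPreconnected.image ?_ _ ((e v).continuousOn_symm.mono (by simp [het]))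
    exact (isConnected_compl_singleton_of_one_lt_rank (by
      rw [← Module.finrank_eq_rank]; simp) _).isPreconnected
  obtain ⟨θ, hθ⟩ := IsLiftOn.exists_rotation_of_isPreconnected hF
    ((e v).open_source.inter (e (-v)).open_source) hconn (hf₁.mono inter_subset_left)
    (hf₂.mono inter_subset_right)
  classical
  let f : M → M := fun x ↦ if P.p x ∈ (e (-v)).source then f₂ x else P.U θ (f₁ x)
  have h₁ : P.IsLiftOn F (e v).source f := by
    refine (hf₁.rotate θ).congr (e v).open_source fun x hx ↦ ?_
    by_cases hx' : P.p x ∈ (e (-v)).source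
    · simp only [f, if_pos hx', hθ x ⟨hx, hx'⟩]
    · simp only [f, if_neg hx']
  have h₂ : P.IsLiftOn F (e (-v)).source f :=
    hf₂.congr (e (-v)).open_source fun x hx ↦ if_pos hx
  refine ⟨f, isLiftOn_of_forall_mem fun q _ ↦ ?_⟩
  by_cases hq : q ∈ (e v).source
  · exact ⟨_, hq, h₁⟩
  · refine ⟨_, ?_, h₂⟩
    rw [hes] at hq ⊢
    rw [notMem_compl_iff, mem_singleton_iff] at hq
    rw [hq]
    exact hv

end ContactCircleBundle

open scoped NNReal

/-! ### Dilatations, essential suprema and lower semicontinuity. -/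

section Dilatation

variable {V V' W W' : Type*}

/-- Trades the quotient of a supremum by an infimum for a strict inequality between two vectors, a
form suited to proving openness. The unit vector with nonzero image keeps the infimum finite, and it
is the witness when the infimum is `0` and the dilatation is `∞`. -/
theorem coe_lt_dilatation_iff {H : Set V} {N₁ : V → ℝ} {N₀ : W → ℝ} {L : V → W}
    (hN₀ : ∀ w, 0 ≤ N₀ w) (h : ∃ X ∈ H, N₁ X = 1 ∧ 0 < N₀ (L X)) (c : ℝ≥0) :
    (c : ℝ≥0∞) < dilatation H N₁ N₀ L ↔
      ∃ X ∈ H, ∃ Y ∈ H, N₁ X = 1 ∧ N₁ Y = 1 ∧ c * N₀ (L Y) < N₀ (L X) := by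
  set mx : ℝ≥0∞ := ⨆ X ∈ {X | X ∈ H ∧ N₁ X = 1}, ENNReal.ofReal (N₀ (L X)) with hmx
  set mn : ℝ≥0∞ := ⨅ X ∈ {X | X ∈ H ∧ N₁ X = 1}, ENNReal.ofReal (N₀ (L X)) with hmn
  have hd : dilatation H N₁ N₀ L = open Classical in if mn = 0 then ⊤ else mx / mn := rfl
  have hle : ∀ X ∈ H, N₁ X = 1 → ENNReal.ofReal (N₀ (L X)) ≤ mx := fun X hX hX1 ↦
    le_iSup₂ (f := fun X _ ↦ ENNReal.ofReal (N₀ (L X))) X ⟨hX, hX1⟩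
  have hge : ∀ X ∈ H, N₁ X = 1 → mn ≤ ENNReal.ofReal (N₀ (L X)) := fun X hX hX1 ↦
    iInf₂_le (f := fun X _ ↦ ENNReal.ofReal (N₀ (L X))) X ⟨hX, hX1⟩
  obtain ⟨X₀, hX₀, hX₀1, hX₀L⟩ := h
  have hmnt : mn ≠ ⊤ := ((hge X₀ hX₀ hX₀1).trans_lt ENNReal.ofReal_lt_top).ne
  have hcast : ∀ X, (c : ℝ≥0∞) * ENNReal.ofReal (N₀ (L X)) = ENNReal.ofReal (c * N₀ (L X)) := by
    intro X
    rw [ENNReal.ofReal_mul (NNReal.coe_nonneg c), ENNReal.ofReal_coe_nnreal]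
  constructor
  · intro hc
    obtain ⟨X, hX, hX1, hXc⟩ : ∃ X ∈ H, N₁ X = 1 ∧ (c : ℝ≥0∞) * mn < ENNReal.ofReal (N₀ (L X)) := by
      by_cases h0 : mn = 0
      · exact ⟨X₀, hX₀, hX₀1, by rw [h0, mul_zero]; exact ENNReal.ofReal_pos.2 hX₀L⟩
      · rw [hd, if_neg h0, ENNReal.lt_div_iff_mul_lt (.inl h0) (.inl hmnt)] at hc
        obtain ⟨X, hXc⟩ := lt_iSup_iff.1 hc
        obtain ⟨⟨hX, hX1⟩, hXc⟩ := lt_iSup_iff.1 hXc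
        exact ⟨X, hX, hX1, hXc⟩
    rw [mul_comm, ← ENNReal.lt_div_iff_mul_lt (.inr hmnt) (.inl ENNReal.coe_ne_top)] at hXc
    obtain ⟨Y, hYc⟩ := iInf_lt_iff.1 hXc
    obtain ⟨⟨hY, hY1⟩, hYc⟩ := iInf_lt_iff.1 hYc
    rw [ENNReal.lt_div_iff_mul_lt (.inr ENNReal.ofReal_ne_top) (.inl ENNReal.coe_ne_top), mul_comm,
      hcast] at hYc
    exact ⟨X, hX, Y, hY, hX1, hY1, (ENNReal.ofReal_lt_ofReal_iff_of_nonneg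
      (mul_nonneg (NNReal.coe_nonneg c) (hN₀ _))).1 hYc⟩
  · rintro ⟨X, hX, Y, hY, hX1, hY1, hXY⟩
    rw [hd]
    split_ifs with h0
    · exact ENNReal.coe_lt_top
    · rw [ENNReal.lt_div_iff_mul_lt (.inl h0) (.inl hmnt)]
      refine (mul_le_mul_right (hge Y hY hY1) _).trans_lt (lt_of_lt_of_le ?_ (hle X hX hX1))
      rw [hcast]
      exact (ENNReal.ofReal_lt_ofReal_iff_of_nonneg (mul_nonneg (NNReal.coe_nonneg c) (hN₀ _))).2 hXY

/-- The dilatation of a map can be computed after identifying the spaces. -/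
theorem dilatation_eq_of_surjOn {H : Set V} {H' : Set V'} {N₁ : V → ℝ} {N₀ : W → ℝ} {L : V → W}
    {N₁' : V' → ℝ} {N₀' : W' → ℝ} {L' : V' → W'} (r : V → V') (hr : r '' H = H')
    (h₁ : ∀ X ∈ H, N₁ X = N₁' (r X)) (h₀ : ∀ X ∈ H, N₀ (L X) = N₀' (L' (r X))) :
    dilatation H N₁ N₀ L = dilatation H' N₁' N₀' L' := by
  have key : ∀ X ∈ {X | X ∈ H ∧ N₁ X = 1}, r X ∈ {X | X ∈ H' ∧ N₁' X = 1} := fun X hX ↦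
    ⟨hr ▸ mem_image_of_mem r hX.1, (h₁ X hX.1).symm.trans hX.2⟩
  have key' : {X | X ∈ H' ∧ N₁' X = 1} = r '' {X | X ∈ H ∧ N₁ X = 1} := by
    refine Subset.antisymm ?_ (image_subset_iff.2 key)
    rintro Y ⟨hY, hY1⟩
    obtain ⟨X, hX, rfl⟩ := hr.symm ▸ hY
    exact ⟨X, ⟨hX, (h₁ X hX).trans hY1⟩, rfl⟩
  have hs : (⨆ X ∈ {X | X ∈ H ∧ N₁ X = 1}, ENNReal.ofReal (N₀ (L X))) =
      ⨆ X ∈ {X | X ∈ H' ∧ N₁' X = 1}, ENNReal.ofReal (N₀' (L' X)) := by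
    rw [key', iSup_image]
    exact iSup_congr fun X ↦ iSup_congr fun hX ↦ by rw [h₀ X hX.1]
  have hi : (⨅ X ∈ {X | X ∈ H ∧ N₁ X = 1}, ENNReal.ofReal (N₀ (L X))) =
      ⨅ X ∈ {X | X ∈ H' ∧ N₁' X = 1}, ENNReal.ofReal (N₀' (L' X)) := by
    rw [key', iInf_image]
    exact iInf_congr fun X ↦ iInf_congr fun hX ↦ by rw [h₀ X hX.1]
  unfold dilatation
  rw [hs, hi]

end Dilatation

section Null

variable {n : ℕ} {X : Type*} [TopologicalSpace X] [ChartedSpace (EuclideanSpace ℝ (Fin n)) X]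

theorem isNull_empty : IsNull n (∅ : Set X) := fun x ↦ by simp

/-- Lebesgue measure is positive on the chart image of a nonempty open set. Consequently an
essential supremum of a lower semicontinuous function is a true supremum. -/
theorem IsNull.eq_empty_of_isOpen {O : Set X} (h : IsNull n O) (hO : IsOpen O) : O = ∅ := by
  by_contra hne
  obtain ⟨x, hx⟩ := nonempty_iff_ne_empty.2 hne
  have h1 : IsOpen (chartAt (EuclideanSpace ℝ (Fin n)) x ''
      (O ∩ (chartAt (EuclideanSpace ℝ (Fin n)) x).source)) := by
    rw [inter_comm]
    exact (chartAt (EuclideanSpace ℝ (Fin n)) x).isOpen_image_source_inter hO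
  exact (h1.measure_pos volume ⟨_, mem_image_of_mem _ ⟨hx, mem_chart_source _ x⟩⟩).ne' (h x)

/-- The essential supremum of a lower semicontinuous function is unchanged by composition with
continuous surjections. -/
theorem manifoldEssSup_comp {m : ℕ} {Y : Type*} [TopologicalSpace Y]
    [ChartedSpace (EuclideanSpace ℝ (Fin m)) Y] {k : X → ℝ≥0∞} (hk : ∀ c, IsOpen {x | c < k x})
    {p : Y → X} (hp : Continuous p) (hps : Function.Surjective p) :
    manifoldEssSup m (k ∘ p) = manifoldEssSup n k := by
  unfold manifoldEssSup
  congr 1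
  ext c
  have hpre : {y | c < (k ∘ p) y} = p ⁻¹' {x | c < k x} := rfl
  simp only [mem_ofPred_eq]
  rw [hpre]
  -- Superlevel sets are open upstairs and downstairs, so being null means being empty, and
  -- emptiness passes both ways through a surjection.
  constructor
  · intro h
    have h1 := h.eq_empty_of_isOpen ((hk c).preimage hp)
    rw [hps.preimage_injective (h1.trans preimage_empty.symm)]
    exact isNull_empty
  · intro h
    rw [h.eq_empty_of_isOpen (hk c), preimage_empty]
    exact isNull_empty

end Null

section Surface

variable {S : Type*} [TopologicalSpace S] [ChartedSpace (EuclideanSpace ℝ (Fin 2)) S]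
  [IsManifold (𝓡 2) ∞ S]

theorem continuousAt_inner_mfderiv (g : SurfaceMetric S) {E : Type*} [NormedAddCommGroup E]
    [NormedSpace ℝ E] {H : E → S} {e : E} (hH : ContMDiffAt 𝓘(ℝ, E) (𝓡 2) 1 H e) (u : E) :
    ContinuousAt (fun y ↦ g.inner (H y) (mfderiv 𝓘(ℝ, E) (𝓡 2) H y u)
      (mfderiv 𝓘(ℝ, E) (𝓡 2) H y u)) e := by
  have h1 := contMDiffAt_mfderiv_const (m := 0) (k := 1) hH (by norm_num) u
  have h2 : ContMDiffAt 𝓘(ℝ, E) ((𝓡 2).prod 𝓘(ℝ, ℝ)) 0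
      (fun y ↦ TotalSpace.mk' ℝ (E := Bundle.Trivial S ℝ) (H y)
        (g.inner (H y) (mfderiv 𝓘(ℝ, E) (𝓡 2) H y u) (mfderiv 𝓘(ℝ, E) (𝓡 2) H y u))) e := by
    apply ContMDiffAt.clm_bundle_apply₂ (F₁ := EuclideanSpace ℝ (Fin 2))
      (F₂ := EuclideanSpace ℝ (Fin 2)) (E₁ := fun q : S ↦ TangentSpace (𝓡 2) q)
      (E₂ := fun q : S ↦ TangentSpace (𝓡 2) q)
    · exact ContMDiffAt.comp e ((g.contMDiff (H e)).of_le (by simp)) (hH.of_le (by simp))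
    · exact h1
    · exact h1
  exact ((Bundle.contMDiffAt_totalSpace).1 h2).2.continuousAt

/-- Homogeneity removes the normalization to unit vectors. The witnesses may then be vectors that
are constant in a chart, which do not remain of unit length as the point moves. -/
theorem coe_lt_surfaceDilatation_iff {g₁ g₀ : SurfaceMetric S} {F : S → S} {q : S}
    (h : ∃ u, mfderiv (𝓡 2) (𝓡 2) F q u ≠ 0) (c : ℝ≥0) :
    (c : ℝ≥0∞) < surfaceDilatation g₁ g₀ F q ↔ ∃ u v : TangentSpace (𝓡 2) q,
      0 < √(g₁.inner q u u) ∧ 0 < √(g₁.inner q v v) ∧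
      c * √(g₀.inner (F q) (mfderiv (𝓡 2) (𝓡 2) F q v) (mfderiv (𝓡 2) (𝓡 2) F q v)) *
        √(g₁.inner q u u) <
      √(g₀.inner (F q) (mfderiv (𝓡 2) (𝓡 2) F q u) (mfderiv (𝓡 2) (𝓡 2) F q u)) *
        √(g₁.inner q v v) := by
  have hscale : ∀ (g : SurfaceMetric S) (q : S) (a : ℝ) (u : TangentSpace (𝓡 2) q),
      √(g.inner q (a • u) (a • u)) = |a| * √(g.inner q u u) := by
    intro g q a u
    simp only [map_smul, smul_apply, smul_eq_mul]
    rw [← mul_assoc, Real.sqrt_mul (mul_self_nonneg a), Real.sqrt_mul_self_eq_abs]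
  have hunit : ∀ u : TangentSpace (𝓡 2) q, 0 < √(g₁.inner q u u) →
      √(g₁.inner q ((√(g₁.inner q u u))⁻¹ • u) ((√(g₁.inner q u u))⁻¹ • u)) = 1 := by
    intro u hu
    rw [hscale, abs_of_pos (inv_pos.2 hu), inv_mul_cancel₀ hu.ne']
  have hscale' : ∀ u : TangentSpace (𝓡 2) q, 0 < √(g₁.inner q u u) →
      √(g₀.inner (F q) (mfderiv (𝓡 2) (𝓡 2) F q ((√(g₁.inner q u u))⁻¹ • u))
        (mfderiv (𝓡 2) (𝓡 2) F q ((√(g₁.inner q u u))⁻¹ • u))) = (√(g₁.inner q u u))⁻¹ *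
      √(g₀.inner (F q) (mfderiv (𝓡 2) (𝓡 2) F q u) (mfderiv (𝓡 2) (𝓡 2) F q u)) := by
    intro u hu
    rw [map_smul, hscale, abs_of_pos (inv_pos.2 hu)]
  have h' : ∃ X ∈ (univ : Set (TangentSpace (𝓡 2) q)), √(g₁.inner q X X) = 1 ∧
      0 < √(g₀.inner (F q) (mfderiv (𝓡 2) (𝓡 2) F q X) (mfderiv (𝓡 2) (𝓡 2) F q X)) := by
    obtain ⟨u, hu⟩ := h
    have hu0 : u ≠ 0 := by
      rintro rfl
      exact hu (map_zero _)
    have hup := Real.sqrt_pos.2 (g₁.pos q u hu0)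
    refine ⟨_, mem_univ _, hunit u hup, ?_⟩
    rw [hscale' u hup]
    exact mul_pos (inv_pos.2 hup) (Real.sqrt_pos.2 (g₀.pos _ _ hu))
  rw [surfaceDilatation, coe_lt_dilatation_iff (fun w ↦ Real.sqrt_nonneg _) h']
  constructor
  · rintro ⟨u, -, v, -, hu, hv, huv⟩
    exact ⟨u, v, by rw [hu]; exact one_pos, by rw [hv]; exact one_pos, by
      rw [hu, hv, mul_one, mul_one]; exact huv⟩
  · rintro ⟨u, v, hu, hv, huv⟩
    refine ⟨_, mem_univ _, _, mem_univ _, hunit u hu, hunit v hv, ?_⟩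
    rw [hscale' u hu, hscale' v hv, ← mul_assoc, mul_comm (c : ℝ), mul_assoc]
    rw [inv_mul_lt_iff₀ hv, ← mul_assoc, mul_comm (√(g₁.inner q v v)), mul_assoc,
      lt_inv_mul_iff₀ hu]
    linarith

/-- The dilatation of a `C¹` map is lower semicontinuous. -/
theorem isOpen_setOf_lt_surfaceDilatation {g₁ g₀ : SurfaceMetric S} {F : S → S}
    (hF : ContMDiff (𝓡 2) (𝓡 2) 1 F) (h : ∀ q, ∃ u, mfderiv (𝓡 2) (𝓡 2) F q u ≠ 0) (c : ℝ≥0∞) :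
    IsOpen {q | c < surfaceDilatation g₁ g₀ F q} := by
  induction c with
  | top => simp
  | coe c =>
    rw [isOpen_iff_mem_nhds]
    intro q₀ hq₀
    obtain ⟨u, v, hu, hv, huv⟩ := (coe_lt_surfaceDilatation_iff (h q₀) c).1 hq₀
    set ψ := extChartAt (𝓡 2) q₀ with hψ
    have hz₀ : ψ q₀ ∈ ψ.target := ψ.map_source (mem_extChartAt_source q₀)
    have hψq : ψ.symm (ψ q₀) = q₀ := ψ.left_inv (mem_extChartAt_source q₀)
    have hsymm : ∀ z ∈ ψ.target, ContMDiffAt (𝓡 2) (𝓡 2) 1 ψ.symm z := fun z hz ↦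
      (contMDiffAt_extChartAt_symm hz).of_le (by norm_cast)
    have hFψ : ∀ z ∈ ψ.target, ContMDiffAt (𝓡 2) (𝓡 2) 1 (F ∘ ψ.symm) z := fun z hz ↦
      (hF _).comp z (hsymm z hz)
    have hchain : ∀ z ∈ ψ.target, ∀ w : EuclideanSpace ℝ (Fin 2),
        mfderiv (𝓡 2) (𝓡 2) (F ∘ ψ.symm) z w =
          mfderiv (𝓡 2) (𝓡 2) F (ψ.symm z) (mfderiv (𝓡 2) (𝓡 2) ψ.symm z w) := fun z hz w ↦
      mfderiv_comp_apply z ((hF _).mdifferentiableAt (by simp))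
        ((hsymm z hz).mdifferentiableAt (by simp)) w
    -- The witnesses at `q₀` are extended as constant fields in the chart. `G₁` and `G₀` are the
    -- lengths of such a field and of its image under `F`; both are continuous at `ψ q₀`, so the
    -- strict inequality persists nearby.
    let G₁ : EuclideanSpace ℝ (Fin 2) → EuclideanSpace ℝ (Fin 2) → ℝ := fun w z ↦
      √(g₁.inner (ψ.symm z) (mfderiv (𝓡 2) (𝓡 2) ψ.symm z w) (mfderiv (𝓡 2) (𝓡 2) ψ.symm z w))
    let G₀ : EuclideanSpace ℝ (Fin 2) → EuclideanSpace ℝ (Fin 2) → ℝ := fun w z ↦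
      √(g₀.inner ((F ∘ ψ.symm) z) (mfderiv (𝓡 2) (𝓡 2) (F ∘ ψ.symm) z w)
        (mfderiv (𝓡 2) (𝓡 2) (F ∘ ψ.symm) z w))
    have hG₁ : ∀ w, ContinuousAt (G₁ w) (ψ q₀) := fun w ↦
      (continuousAt_inner_mfderiv g₁ (hsymm _ hz₀) w).sqrt
    have hG₀ : ∀ w, ContinuousAt (G₀ w) (ψ q₀) := fun w ↦
      (continuousAt_inner_mfderiv g₀ (hFψ _ hz₀) w).sqrt
    have hcongr : ∀ (g : SurfaceMetric S) {x x' : S} (_ : x = x')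
        {w w' : EuclideanSpace ℝ (Fin 2)} (_ : w = w'), g.inner x w w = g.inner x' w' w' := by
      rintro g x _ rfl w _ rfl
      rfl
    have hDcongr : ∀ {x x' : S} (_ : x = x') {w w' : EuclideanSpace ℝ (Fin 2)} (_ : w = w'),
        (mfderiv (𝓡 2) (𝓡 2) F x w : EuclideanSpace ℝ (Fin 2)) =
          mfderiv (𝓡 2) (𝓡 2) F x' w' := by
      rintro x _ rfl w _ rfl
      rfl
    let φ : TangentSpace (𝓡 2) q₀ → EuclideanSpace ℝ (Fin 2) := fun w ↦ mfderiv (𝓡 2) (𝓡 2) ψ q₀ w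
    have hφ : ∀ w : TangentSpace (𝓡 2) q₀, (mfderiv (𝓡 2) (𝓡 2) ψ.symm (ψ q₀) (φ w) :
        EuclideanSpace ℝ (Fin 2)) = w := fun w ↦
      mfderiv_extChartAt_symm_apply (mem_extChartAt_source q₀) w
    have hφ₁ : ∀ w : TangentSpace (𝓡 2) q₀, G₁ (φ w) (ψ q₀) = √(g₁.inner q₀ w w) := fun w ↦
      congrArg Real.sqrt (hcongr g₁ hψq (hφ w))
    have hφ₀ : ∀ w : TangentSpace (𝓡 2) q₀, G₀ (φ w) (ψ q₀) =
        √(g₀.inner (F q₀) (mfderiv (𝓡 2) (𝓡 2) F q₀ w) (mfderiv (𝓡 2) (𝓡 2) F q₀ w)) := fun w ↦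
      congrArg Real.sqrt (hcongr g₀ (congrArg F hψq)
        ((hchain _ hz₀ (φ w)).trans (hDcongr hψq (hφ w))))
    rw [← hφ₁] at hu hv huv
    rw [← hφ₁, ← hφ₀, ← hφ₀] at huv
    have hev : ∀ᶠ z in 𝓝 (ψ q₀), (c : ℝ≥0∞) < surfaceDilatation g₁ g₀ F (ψ.symm z) := by
      filter_upwards [(hG₁ (φ u)).eventually (lt_mem_nhds hu),
        (hG₁ (φ v)).eventually (lt_mem_nhds hv),
        ((continuousAt_const.mul (hG₀ (φ v))).mul (hG₁ (φ u))).eventually_lt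
          ((hG₀ (φ u)).mul (hG₁ (φ v))) huv,
        (isOpen_extChartAt_target (I := 𝓡 2) q₀).mem_nhds hz₀] with z h1 h2 h3 h4
      refine (coe_lt_surfaceDilatation_iff (h _) c).2 ⟨_, _, h1, h2, ?_⟩
      have h5 : ∀ w, G₀ w z = √(g₀.inner (F (ψ.symm z))
          (mfderiv (𝓡 2) (𝓡 2) F (ψ.symm z) (mfderiv (𝓡 2) (𝓡 2) ψ.symm z w))
          (mfderiv (𝓡 2) (𝓡 2) F (ψ.symm z) (mfderiv (𝓡 2) (𝓡 2) ψ.symm z w))) := fun w ↦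
        congrArg Real.sqrt (hcongr g₀ rfl (hchain z h4 w))
      have h6 : c * G₀ (φ v) z * G₁ (φ u) z < G₀ (φ u) z * G₁ (φ v) z := h3
      rw [h5, h5] at h6
      exact h6
    filter_upwards [(continuousAt_extChartAt (I := 𝓡 2) q₀).eventually hev,
      extChartAt_source_mem_nhds (I := 𝓡 2) q₀] with q h1 h2
    rwa [ψ.left_inv h2] at h1

end Surface

/-! ### Quasiconformality and dilatation of `C¹` lifts. -/

/-- A `C¹` map is absolutely continuous along all smooth curves. -/
theorem acAlong_of_contMDiff {M : Type u} [TopologicalSpace M]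
    [ChartedSpace (EuclideanSpace ℝ (Fin 3)) M] {f : M → M} (hf : ContMDiff (𝓡 3) (𝓡 3) 1 f)
    (γ : Set M) : ACAlong f γ := by
  intro c hc _ _ a b h hh
  have h1 : ContMDiff 𝓘(ℝ, ℝ) 𝓘(ℝ, ℝ) 1 (h ∘ f ∘ c) :=
    (hh.of_le (by norm_cast)).comp (hf.comp (hc.of_le (by norm_cast)))
  exact h1.contDiff.contDiffOn.absolutelyContinuousOnInterval

theorem isACL_of_contMDiff {M : Type u} [TopologicalSpace M]
    [ChartedSpace (EuclideanSpace ℝ (Fin 3)) M] [IsManifold (𝓡 3) ∞ M] (η : OneForm 3 M)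
    {f : M → M} (hf : ContMDiff (𝓡 3) (𝓡 3) 1 f) : IsACL η f := by
  intro B _ _ _ _ U proj _ V σ _ _ _ _
  simp [acAlong_of_contMDiff hf]

namespace ContactCircleBundle

variable {M : Type*} [TopologicalSpace M] [ChartedSpace (EuclideanSpace ℝ (Fin 3)) M]
  [IsManifold (𝓡 3) ∞ M] {S : Type*} [TopologicalSpace S]
  [ChartedSpace (EuclideanSpace ℝ (Fin 2)) S] [IsManifold (𝓡 2) ∞ S]
  {P : ContactCircleBundle M S}

/-- A lift of a homeomorphism is a homeomorphism. -/
theorem IsLiftOn.exists_homeomorph [T2Space M] [CompactSpace M] {F : S ≃ₜ S} {f : M → M}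
    (hf : P.IsLiftOn F univ f) : ∃ f' : M ≃ₜ M, ⇑f' = f := by
  have hinj : Function.Injective f := by
    intro x y hxy
    have h1 : P.p x = P.p y := F.injective (by
      rw [← hf.p_map x (mem_univ _), ← hf.p_map y (mem_univ _), hxy])
    obtain ⟨θ, rfl⟩ := (P.p_eq_iff x y).1 h1
    rw [hf.map_U θ x (mem_univ _)] at hxy
    rw [P.U_free θ _ hxy.symm, P.U_zero]
  have hsurj : Function.Surjective f := by
    intro y
    obtain ⟨x, hx⟩ := P.p_surjective (F.symm (P.p y))
    obtain ⟨θ, hθ⟩ := (P.p_eq_iff (f x) y).1 (by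
      rw [hf.p_map x (mem_univ _), hx, F.apply_symm_apply])
    exact ⟨P.U θ x, by rw [hf.map_U θ x (mem_univ _), hθ]⟩
  have hc : Continuous f := continuous_iff_continuousAt.2 fun x ↦
    (hf.contMDiffAt x (mem_univ _)).continuousAt
  exact ⟨Continuous.homeoOfEquivCompactToT2 (f := Equiv.ofBijective f ⟨hinj, hsurj⟩) hc, rfl⟩

/-- The area form is nondegenerate because `ω(w, J' w) = g(w, w)`. With `w = p_* T` and `v` a lift
of `J' w`, the equation `dη(T, v) = 0` says `g(w, w) = 0`. -/
theorem mfderiv_p_T {g : SurfaceMetric S}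
    {J' : ∀ q : S, TangentSpace (𝓡 2) q →L[ℝ] TangentSpace (𝓡 2) q}
    (hJ' : IsComplexStructureOf g P.area J') (x : M) :
    mfderiv (𝓡 3) (𝓡 2) P.p x (P.T x) = 0 := by
  by_contra h
  obtain ⟨v, hv⟩ := P.p_submersion x (J' _ (mfderiv (𝓡 3) (𝓡 2) P.p x (P.T x)))
  have h1 := P.dη_T x v
  rw [P.dη_eq, hv, ← hJ'] at h1
  exact (g.pos _ _ h).ne' h1

/-- The projection maps contact planes onto tangent planes. -/
theorem image_contactPlane {g : SurfaceMetric S}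
    {J' : ∀ q : S, TangentSpace (𝓡 2) q →L[ℝ] TangentSpace (𝓡 2) q}
    (hJ' : IsComplexStructureOf g P.area J') (x : M) :
    mfderiv (𝓡 3) (𝓡 2) P.p x '' contactPlane P.η x = univ := by
  refine eq_univ_of_forall fun w ↦ ?_
  obtain ⟨v, rfl⟩ := P.p_submersion x w
  refine ⟨v - P.η x v • P.T x, ?_, ?_⟩
  · change P.η x (v - P.η x v • P.T x) = 0
    rw [map_sub, map_smul, P.η_T, smul_eq_mul, mul_one, sub_self]
  · rw [map_sub, map_smul, mfderiv_p_T hJ', smul_zero, sub_zero]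

/-- The Levi norm is the norm of the projection. -/
theorem norm_eq_of_isCRProjection {J : CRStructure P.η} {g : SurfaceMetric S}
    (h : IsCRProjection P J g) {x : M} {X : TangentSpace (𝓡 3) x} (hX : X ∈ contactPlane P.η x) :
    J.norm x X = √(g.inner (P.p x) (mfderiv (𝓡 3) (𝓡 2) P.p x X)
      (mfderiv (𝓡 3) (𝓡 2) P.p x X)) := by
  obtain ⟨J', hJ', hJ⟩ := h
  rw [CRStructure.norm, P.dη_eq, hJ x X hX, ← hJ', abs_of_nonneg]
  by_cases h0 : mfderiv (𝓡 3) (𝓡 2) P.p x X = 0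
  · rw [h0, map_zero]
  · exact (g.pos _ _ h0).le

theorem IsLiftOn.mfderiv_mem_contactPlane {F : S → S} {W : Set S} {f : M → M}
    (hf : P.IsLiftOn F W f) {x : M} (hx : P.p x ∈ W) {X : TangentSpace (𝓡 3) x}
    (hX : X ∈ contactPlane P.η x) :
    mfderiv (𝓡 3) (𝓡 3) f x X ∈ contactPlane P.η (f x) :=
  (hf.η_mfderiv x hx X).trans hX

/-- The dilatation of a lift. -/
theorem IsLiftOn.crDilatation_eq {F : S → S} (hF : ContMDiff (𝓡 2) (𝓡 2) 1 F) {f : M → M}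
    (hf : P.IsLiftOn F univ f) {J₁ J₀ : CRStructure P.η} {g₁ g₀ : SurfaceMetric S}
    (hp₁ : IsCRProjection P J₁ g₁) (hp₀ : IsCRProjection P J₀ g₀) (x : M) :
    crDilatation J₁ J₀ f x = surfaceDilatation g₁ g₀ F (P.p x) := by
  refine dilatation_eq_of_surjOn (mfderiv (𝓡 3) (𝓡 2) P.p x)
    (image_contactPlane hp₁.choose_spec.1 x) (fun X hX ↦ norm_eq_of_isCRProjection hp₁ hX)
    fun X hX ↦ (norm_eq_of_isCRProjection hp₀ (hf.mfderiv_mem_contactPlane (mem_univ _) hX)).trans ?_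
  have hpx : ∀ y, MDifferentiableAt (𝓡 3) (𝓡 2) P.p y := fun y ↦
    (P.p_smooth y).mdifferentiableAt (by simp)
  have e1 : mfderiv (𝓡 3) (𝓡 2) (P.p ∘ f) x X =
      mfderiv (𝓡 3) (𝓡 2) P.p (f x) (mfderiv (𝓡 3) (𝓡 3) f x X) :=
    mfderiv_comp_apply x (hpx _) ((hf.contMDiffAt x (mem_univ _)).mdifferentiableAt (by simp)) X
  have e2 : mfderiv (𝓡 3) (𝓡 2) (F ∘ P.p) x X =
      mfderiv (𝓡 2) (𝓡 2) F (P.p x) (mfderiv (𝓡 3) (𝓡 2) P.p x X) :=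
    mfderiv_comp_apply x ((hF _).mdifferentiableAt (by simp)) (hpx x) X
  have e3 : P.p ∘ f =ᶠ[𝓝 x] F ∘ P.p := .of_forall fun y ↦ hf.p_map y (mem_univ _)
  have hcongr : ∀ {q q' : S} (_ : q = q') {w w' : EuclideanSpace ℝ (Fin 2)} (_ : w = w'),
      g₀.inner q w w = g₀.inner q' w' w' := by
    rintro q _ rfl w _ rfl
    rfl
  exact congrArg Real.sqrt (hcongr (hf.p_map x (mem_univ _))
    (e1.symm.trans ((mfderiv_apply_congr e3 X).trans e2)))

end ContactCircleBundle

/-- If `F_* u` vanished, area preservation would give `ω(u, J' u) = g(u, u) = 0`. This supplies the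
nondegeneracy needed for semicontinuity of the dilatation. -/
theorem PreservesArea.exists_mfderiv_ne_zero {S : Type*} [TopologicalSpace S]
    [ChartedSpace (EuclideanSpace ℝ (Fin 2)) S] [IsManifold (𝓡 2) ∞ S] {area : BilinField 2 S}
    {F : S → S} (hFa : PreservesArea area F) {g : SurfaceMetric S} {q : S}
    {J' : ∀ q : S, TangentSpace (𝓡 2) q →L[ℝ] TangentSpace (𝓡 2) q}
    (hJ' : IsComplexStructureOf g area J') : ∃ u, mfderiv (𝓡 2) (𝓡 2) F q u ≠ 0 := by
  obtain ⟨u, hu⟩ : ∃ u : EuclideanSpace ℝ (Fin 2), u ≠ 0 := exists_ne 0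
  refine ⟨u, fun h ↦ ?_⟩
  have h1 := hFa q u (J' q u)
  rw [h, map_zero] at h1
  exact (g.pos q u hu).ne' ((hJ' q u u).trans h1.symm)

end CRQuasiconformal
end

/-! ### The main theorem. -/

open CRQuasiconformal in
theorem theorem3p6
    {M : Type*} [TopologicalSpace M] [T2Space M] [CompactSpace M]
    [ChartedSpace (EuclideanSpace ℝ (Fin 3)) M] [IsManifold (𝓡 3) ∞ M]
    {S : Type*} [TopologicalSpace S]
    [ChartedSpace (EuclideanSpace ℝ (Fin 2)) S] [IsManifold (𝓡 2) ∞ S]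
    (P : ContactCircleBundle M S)
    (hS : Nonempty (S ≃ₜ Metric.sphere (0 : EuclideanSpace ℝ (Fin 3)) 1))
    (g₁ g₀ : SurfaceMetric S) (hg₁ : IsAreaForm g₁ P.area) (hg₀ : IsAreaForm g₀ P.area)
    (J₁ J₀ : CRStructure P.η) (hJ₁ : IsInvariant P J₁) (hJ₀ : IsInvariant P J₀)
    (hp₁ : IsCRProjection P J₁ g₁) (hp₀ : IsCRProjection P J₀ g₀)
    (F : S ≃ₜ S) (hF : ContMDiff (𝓡 2) (𝓡 2) 1 F)
    (hFq : IsSurfaceQuasiconformal g₁ g₀ F) (hFa : PreservesArea P.area F) :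
    ∃ f : M ≃ₜ M, IsEquivariant P f ∧ IsCRQuasiconformal J₁ J₀ f ∧
      (∀ x, P.p (f x) = F (P.p x)) ∧
      crMaxDilatation J₁ J₀ f = surfaceMaxDilatation g₁ g₀ F := by
  obtain ⟨f₀, hf₀⟩ := ContactCircleBundle.exists_isLiftOn_univ (P := P) hS hF hFa
  obtain ⟨f, rfl⟩ := hf₀.exists_homeomorph
  have hK : crMaxDilatation J₁ J₀ f = surfaceMaxDilatation g₁ g₀ F := by
    have h1 : crDilatation J₁ J₀ f = surfaceDilatation g₁ g₀ F ∘ P.p :=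
      funext fun x ↦ hf₀.crDilatation_eq hF hp₁ hp₀ x
    rw [crMaxDilatation, h1]
    exact manifoldEssSup_comp (isOpen_setOf_lt_surfaceDilatation hF fun q ↦
      hFa.exists_mfderiv_ne_zero hp₁.choose_spec.1) P.p_smooth.continuous P.p_surjective
  refine ⟨f, fun θ x ↦ hf₀.map_U θ x (Set.mem_univ _), ⟨?_, ?_, ?_⟩,
    fun x ↦ hf₀.p_map x (Set.mem_univ _), hK⟩
  · exact isACL_of_contMDiff P.η fun x ↦ hf₀.contMDiffAt x (Set.mem_univ _)
  · convert isNull_empty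
    -- The exceptional set is empty: `f` is `C¹` and preserves `η` at every point.
    refine Set.eq_empty_of_forall_notMem fun x hx ↦ hx ⟨?_, fun X hX ↦ ?_⟩
    · exact (hf₀.contMDiffAt x (Set.mem_univ _)).mdifferentiableAt (by simp)
    · exact hf₀.mfderiv_mem_contactPlane (Set.mem_univ _) hX
  · rw [hK]
    exact hFq.bounded
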